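/- **Setting.** Let $d\ge 2$, $N\ge 1$ and $Y_i=x_i^{T}\theta^*+\epsilon_i$, $i=1,\dots,N$, with $x_i,\theta^*\in\mathbb R^d$, where the pairs $(x_i,\epsilon_i)$ are independent across $i$, $\mathbb E x_i=0$ and $\mathbb E(\epsilon_i\mid x_i)=0$ (the noise need be neither identically distributed nor independent of the design). Let $\sum_{j=1}^d|\theta^*_j|^q\le\rho$ with $0\le q\le 1$, $\rho>1$ (for $q=0$ the sum counts the nonzero entries). For data $(\widetilde Y_i,\widetilde x_i)_{i\le N}$ put $\widehat\Sigma_{Yx}=N^{-1}\sum_i\widetilde Y_i\widetilde x_i$, $\widehat\Sigma_{xx}=N^{-1}\sum_i\widetilde x_i\widetilde x_i^{T}$, and let $\widehat\theta$ be any element of $$\operatorname*{argmin}_{\theta\in\mathbb R^d}\; -\widehat\Sigma_{Yx}^{T}\theta+\tfrac12\theta^{T}\widehat\Sigma_{xx}\theta+\lambda_N\|\theta\|_1 .$$ The sub-Gaussian norm is $\|X\|_{\psi_2}=\sup_{p\ge1}(\mathbb E|X|^p)^{1/p}/\sqrt p$ for a random variable and $\|x\|_{\psi_2}=\sup_{\|v\|_2=1}\|v^Tx\|_{\psi_2}$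 for a random vector. **(a) Sub-Gaussian design.** Suppose that the $x_i$ are identically distributed, $\|x_i\|_{\psi_2}\le\kappa_0$, $\lambda_{\min}(\mathbb E x_1x_1^{T})\ge\kappa_{\mathcal L}>0$, and $\mathbb E|Y_i|^{2k}\le M$ for all $i$ and some $k>1$. Let $\widetilde Y_i=\mathrm{sgn}(Y_i)(|Y_i|\wedge\tau)$, $\widetilde x_i=x_i$, with $a\sqrt{N/\log d}\le\tau\le b\sqrt{N/\log d}$, $0<a\le b$. There are positive constants $\nu_1,C_2,C_3$ depending only on $\kappa_0,\kappa_{\mathcal L},M,k,a,b$, and for every $\delta>0$ positive constants $\gamma_1,C_1$ depending only on these parameters and $\delta$, such that: if $\log d/N<\gamma_1$, then $$P\Big(\|\widehat\Sigma_{Yx}-\widehat\Sigma_{xx}\theta^*\|_\infty\ge\nu_1\sqrt{\delta\log d/N}\Big)\le 2d^{1-\delta};$$ and if $\lambda_N=2\nu_1\sqrt{\delta\log d/N}$ and $\rho(\log d/N)^{1-q/2}\le C_1$, then with probability at least $1-3d^{1-\delta}$ $$\|\widehat\theta-\theta^*\|_2^2\le C_2\,\rho\Big(\frac{\delta\log d}{N}\Big)^{1-q/2}\quad\text{and}\quad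 \|\widehat\theta-\theta^*\|_1\le C_3\,\rho\Big(\frac{\delta\log d}{N}\Big)^{(1-q)/2}.$$ **(b) Design with bounded fourth moments.** Suppose that $\|\theta^*\|_1\le R$, and for all $i$: $\mathbb E|x_{ij_1}x_{ij_2}|^2\le M$ for $1\le j_1,j_2\le d$, $\mathbb E|Y_i|^4\le M$, and $\lambda_{\min}(\mathbb E x_ix_i^{T})\ge\kappa_{\mathcal L}>0$. Let $\widetilde Y_i=\mathrm{sgn}(Y_i)(|Y_i|\wedge\tau_1)$, $\widetilde x_{ij}=\mathrm{sgn}(x_{ij})(|x_{ij}|\wedge\tau_2)$. Let $0<a\le b$. There are positive constants $\nu_2,C_5,C_6$ depending only on $\kappa_{\mathcal L},M,R,a,b$, and for every $\delta>0$ a positive constant $C_4$ depending only on these parameters and $\delta$, such that for all $\tau_1,\tau_2$ between $a\,(N/(\delta\log d))^{1/4}$ and $b\,(N/(\delta\log d))^{1/4}$ (that is, $\tau_1,\tau_2\asymp(N/\log d)^{1/4}$ for each fixed $\delta$) $$P\Big(\|\widehat\Sigma_{Yx}-\widehat\Sigma_{xx}\theta^*\|_\infty>\nu_2\sqrt{\delta\log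 d/N}\Big)\le 2d^{1-\delta};$$ and if $\lambda_N=2\nu_2\sqrt{\delta\log d/N}$ and $\rho(\log d/N)^{(1-q)/2}\le C_4$, then with probability at least $1-3d^{1-\delta}$ $$\|\widehat\theta-\theta^*\|_2^2\le C_5\,\rho\Big(\frac{\delta\log d}{N}\Big)^{1-q/2}\quad\text{and}\quad \|\widehat\theta-\theta^*\|_1\le C_6\,\rho\Big(\frac{\delta\log d}{N}\Big)^{(1-q)/2}.$$ -/

import Mathlib

open MeasureTheory ProbabilityTheory Matrix
open scoped ENNReal

noncomputable section

namespace RobustRegression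

/-! ### Norms of vectors -/

/-- The `ℓ₁` norm of a vector. -/
def l1Norm {d : ℕ} (v : Fin d → ℝ) : ℝ := ∑ j, |v j|

/-- The `ℓ₂` (Euclidean) norm of a vector. -/
def l2Norm {d : ℕ} (v : Fin d → ℝ) : ℝ := √(∑ j, v j ^ 2)

/-- `∑ |θ_j|^q`, with the convention `0 ^ 0 = 0`, so that for `q = 0` it counts the nonzero
entries (`Real.rpow` has `0 ^ 0 = 1`, hence the case distinction). -/
def lqSum {d : ℕ} (q : ℝ) (θ : Fin d → ℝ) : ℝ := ∑ j, if θ j = 0 then 0 else |θ j| ^ q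

/-! ### Moments, sub-Gaussian norm, smallest eigenvalue -/

/-- The absolute moment `E |X|^p`, as an extended nonnegative number. -/
def absMoment {Ω : Type*} [MeasurableSpace Ω] (μ : Measure Ω) (p : ℝ) (X : Ω → ℝ) : ℝ≥0∞ :=
  ∫⁻ ω, ENNReal.ofReal (|X ω| ^ p) ∂μ

/-- The sub-Gaussian norm `sup_{p ≥ 1} (E |X|^p)^{1/p} / √p` of a random variable. -/
def psi2Norm {Ω : Type*} [MeasurableSpace Ω] (μ : Measure Ω) (X : Ω → ℝ) : ℝ≥0∞ :=
  ⨆ (p : ℝ) (_ : 1 ≤ p), eLpNorm X (ENNReal.ofReal p) μ / ENNReal.ofReal (√p)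

/-- The sub-Gaussian norm of a random vector: the supremum over the unit sphere of the
sub-Gaussian norms of its one-dimensional projections. -/
def psi2NormVec {Ω : Type*} [MeasurableSpace Ω] {d : ℕ} (μ : Measure Ω)
    (X : Ω → Fin d → ℝ) : ℝ≥0∞ :=
  ⨆ (v : Fin d → ℝ) (_ : l2Norm v = 1), psi2Norm μ (fun ω => v ⬝ᵥ X ω)

/-- The matrix `E X Xᵀ`. -/
def secondMoment {Ω : Type*} [MeasurableSpace Ω] {d : ℕ} (μ : Measure Ω)
    (X : Ω → Fin d → ℝ) : Matrix (Fin d) (Fin d) ℝ :=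
  Matrix.of fun j k => ∫ ω, X ω j * X ω k ∂μ

/-- `λ_min(A) ≥ κ`, for a symmetric matrix `A`: all eigenvalues of `A` are at least `κ`. -/
def MinEigenvalueGE {d : ℕ} (A : Matrix (Fin d) (Fin d) ℝ) (κ : ℝ) : Prop :=
  ∀ t : ℝ, Module.End.HasEigenvalue (Matrix.toLin' A) t → κ ≤ t

/-! ### The linear model -/

/-- The linear model `Y_i = x_iᵀ θ + ε_i`, `i = 1, …, N`: the observations `(x_i, ε_i)` are
independent across `i` (for a given `i`, the noise may depend on the design), `E x_i = 0` and
`E (ε_i | x_i) = 0`. -/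
structure IsLinearModel {Ω : Type*} [MeasurableSpace Ω] {d N : ℕ} (μ : Measure Ω)
    (x : Fin N → Ω → Fin d → ℝ) (ε Y : Fin N → Ω → ℝ) (θ : Fin d → ℝ) : Prop where
  measurable_design : ∀ i, Measurable (x i)
  measurable_noise : ∀ i, Measurable (ε i)
  response_eq : ∀ i ω, Y i ω = x i ω ⬝ᵥ θ + ε i ω
  indep : iIndepFun (fun i ω => (x i ω, ε i ω)) μ
  integrable_design : ∀ i, Integrable (x i) μ
  mean_design : ∀ i, ∫ ω, x i ω ∂μ = 0
  integrable_noise : ∀ i, Integrable (ε i) μ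
  condMean_noise : ∀ i, μ[ε i | MeasurableSpace.comap (x i) inferInstance] =ᵐ[μ] 0

/-- Sub-Gaussian design: the `x_i` are identically distributed (independence is part of
`IsLinearModel`), `‖x_i‖_{ψ₂} ≤ κ₀` and `λ_min(E x_i x_iᵀ) ≥ κL`. -/
structure SubGaussianDesign {Ω : Type*} [MeasurableSpace Ω] {d N : ℕ} (μ : Measure Ω)
    (x : Fin N → Ω → Fin d → ℝ) (κ₀ κL : ℝ) : Prop where
  identDistrib : ∀ i j, IdentDistrib (x i) (x j) μ μ
  psi2_le : ∀ i, psi2NormVec μ (x i) ≤ ENNReal.ofReal κ₀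
  minEigenvalue : ∀ i, MinEigenvalueGE (secondMoment μ (x i)) κL

/-- Design with bounded fourth moments: `E |x_{ij} x_{ik}|² ≤ M` for all `j, k`, and
`λ_min(E x_i x_iᵀ) ≥ κL`. -/
structure BoundedMomentDesign {Ω : Type*} [MeasurableSpace Ω] {d N : ℕ} (μ : Measure Ω)
    (x : Fin N → Ω → Fin d → ℝ) (M κL : ℝ) : Prop where
  moment_le : ∀ i j k, absMoment μ 2 (fun ω => x i ω j * x i ω k) ≤ ENNReal.ofReal M
  minEigenvalue : ∀ i, MinEigenvalueGE (secondMoment μ (x i)) κL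

/-! ### The estimator -/

/-- Truncation `sgn(y) (|y| ∧ τ)`. -/
def trunc (τ y : ℝ) : ℝ := Real.sign y * min |y| τ

/-- The truncated sample of responses. -/
def truncResponse {Ω : Type*} {N : ℕ} (τ : ℝ) (Y : Fin N → Ω → ℝ) (ω : Ω) : Fin N → ℝ :=
  fun i => trunc τ (Y i ω)

/-- The sample of design vectors, not truncated. -/
def design {Ω : Type*} {d N : ℕ} (x : Fin N → Ω → Fin d → ℝ) (ω : Ω) : Fin N → Fin d → ℝ :=
  fun i => x i ω

/-- The sample of design vectors, truncated entry by entry. -/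
def truncDesign {Ω : Type*} {d N : ℕ} (τ : ℝ) (x : Fin N → Ω → Fin d → ℝ) (ω : Ω) :
    Fin N → Fin d → ℝ :=
  fun i j => trunc τ (x i ω j)

/-- `N⁻¹ ∑ y_i x_i`. -/
def crossCov {d N : ℕ} (y : Fin N → ℝ) (X : Fin N → Fin d → ℝ) : Fin d → ℝ :=
  (N : ℝ)⁻¹ • ∑ i, y i • X i

/-- `N⁻¹ ∑ x_i x_iᵀ`. -/
def sampleCov {d N : ℕ} (X : Fin N → Fin d → ℝ) : Matrix (Fin d) (Fin d) ℝ :=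
  (N : ℝ)⁻¹ • ∑ i, Matrix.vecMulVec (X i) (X i)

/-- The `ℓ₁`-penalized quadratic loss
`- Σ̂_{Yx}ᵀ θ + (1/2) θᵀ Σ̂_{xx} θ + lam ‖θ‖₁` of the (truncated) data `y`, `X`. -/
def penalizedLoss {d N : ℕ} (y : Fin N → ℝ) (X : Fin N → Fin d → ℝ) (lam : ℝ)
    (θ : Fin d → ℝ) : ℝ :=
  -(crossCov y X ⬝ᵥ θ) + 1 / 2 * (θ ⬝ᵥ (sampleCov X *ᵥ θ)) + lam * l1Norm θ

/-- `θ` belongs to the argmin over `ℝ^d` of the penalized loss. -/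
def IsEstimate {d N : ℕ} (y : Fin N → ℝ) (X : Fin N → Fin d → ℝ) (lam : ℝ)
    (θ : Fin d → ℝ) : Prop :=
  ∀ θ' : Fin d → ℝ, penalizedLoss y X lam θ ≤ penalizedLoss y X lam θ'

/-- `‖Σ̂_{Yx} - Σ̂_{xx} θ‖_∞` (the norm on `Fin d → ℝ` is the maximum norm). -/
def scoreNorm {d N : ℕ} (y : Fin N → ℝ) (X : Fin N → Fin d → ℝ) (θ : Fin d → ℝ) : ℝ :=
  ‖crossCov y X - sampleCov X *ᵥ θ‖

end RobustRegression

end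

/-!
The two parts share one deterministic argument. Write `L = log d` and `s = √(δ L / N)`. On the
event that the score is at most `ν s` and the sample covariance satisfies
`vᵀ Σ̂ v ≥ κ ‖v‖₂² - B ‖v‖₁²` for all `v`, the basic inequality for the penalized estimator, with
the coordinates of `θ*` split at the level `s`, gives an `ℓ₂` error of order `ρ s^{2-q}` (squared)
and an `ℓ₁` error of order `ρ s^{1-q}`, provided that `B ρ s^{-q}` is small compared with `κ`
(`estimate_error_le`). It remains to bound the probabilities of the two events. If `δ ≤ 1` the
claimed bounds are at least `1`, so let `δ > 1`.

*Score.* The Chernoff bound is used with the parameter `s` itself: if `E Z² e^{s|Z|} ≤ V` and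
`|E Z| ≤ C s` for each summand, the average of `N` independent summands exceeds `(C + V + 1) s` in
absolute value with probability at most `2 e^{-N s²} = 2 d^{-δ}` (`measureReal_abs_mean_ge_le`),
and a union bound over coordinates gives `2 d^{1-δ}`. The normal equations reduce the mean to the truncation bias, which
is of order `s` for the chosen levels. For bounded fourth moments the truncated products are at
most a constant times `1 / s`, so the Bernstein condition is immediate. For the sub-Gaussian
design `s |Ỹ| ≤ b √δ`, which depends on `δ`, whereas `V` may not; but `e^{s |Ỹ| |x|}` exceeds
`e^{|x|}` only where `s |Y| > 1`, and the moment of order `2k > 2` makes this contribution as small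
as one likes once `s` is small in terms of `δ` (`score_integrand_le`).

*Restricted lower bound.* For bounded fourth moments every entry of the truncated sample covariance
is within `ν' s` of its target, so `B = ν' s`. For the sub-Gaussian design one needs `B` of order
`L / N`. For a fixed `z` the average of `(zᵀ x_i)²` is nonnegative with bounded second moments, hence
at least half its mean outside an event of probability `e^{-cN}`. This is applied to the `(2d)^n`
sums of `n ≈ c N / (4 L)` signed basis vectors, and Maurey's empirical method transfers the bound
from these vectors to all vectors, at the cost of `‖v‖₁²` times the largest diagonal entry of the
sample covariance divided by `n - 1` (`quadratic_ge_of_signedSums`). No covering of a sphere is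
needed.
-/

namespace RobustRegression

/-! ### Exponential inequalities and Chernoff bounds -/

lemma exp_le_one_add_add_sq_mul (x : ℝ) :
    Real.exp x ≤ 1 + x + x ^ 2 * Real.exp |x| := by
  have h := Complex.norm_exp_sub_sum_le_norm_mul_exp (x : ℂ) 2
  have h2 : Complex.exp x - ∑ m ∈ Finset.range 2, (x : ℂ) ^ m / m.factorial
      = ((Real.exp x - (1 + x) : ℝ) : ℂ) := by
    simp [Finset.sum_range_succ]
  rw [h2, Complex.norm_real, Complex.norm_real, Real.norm_eq_abs, Real.norm_eq_abs, sq_abs] at h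
  linarith [le_abs_self (Real.exp x - (1 + x))]

lemma exp_neg_le_one_sub_add_sq {x : ℝ} (hx : 0 ≤ x) :
    Real.exp (-x) ≤ 1 - x + x ^ 2 := by
  rw [Real.exp_neg]
  have h1 := Real.add_one_le_exp x
  have h2 : (1 - x + x ^ 2) * (x + 1) = 1 + x ^ 3 := by ring
  rw [inv_le_iff_one_le_mul₀ (Real.exp_pos x)]
  have h3 : 0 ≤ 1 - x + x ^ 2 := by nlinarith [sq_nonneg (x - 1)]
  nlinarith [pow_nonneg hx 3, mul_le_mul_of_nonneg_left h1 h3]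

section Chernoff

variable {Ω : Type*} [MeasurableSpace Ω] {μ : Measure Ω} {N : ℕ}

/-- A nonnegative measurable function below an integrable one is integrable, with smaller
integral. -/
lemma integrable_and_integral_le {f g : Ω → ℝ} (hf : Measurable f) (hg : Integrable g μ)
    (h0 : ∀ ω, 0 ≤ f ω) (h : ∀ ω, f ω ≤ g ω) :
    Integrable f μ ∧ ∫ ω, f ω ∂μ ≤ ∫ ω, g ω ∂μ := by
  have hi : Integrable f μ := hg.mono' hf.aestronglyMeasurable
    (Filter.Eventually.of_forall fun ω => by rw [Real.norm_of_nonneg (h0 ω)]; exact h ω)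
  exact ⟨hi, integral_mono hi hg h⟩

variable [IsProbabilityMeasure μ]

lemma integral_one_add_mul_add_mul {X Y : Ω → ℝ} (hX : Integrable X μ) (hY : Integrable Y μ)
    (a b : ℝ) :
    ∫ ω, (1 + a * X ω + b * Y ω) ∂μ = 1 + a * ∫ ω, X ω ∂μ + b * ∫ ω, Y ω ∂μ := by
  have h1 : Integrable (fun ω => 1 + a * X ω) μ := (integrable_const _).add (hX.const_mul a)
  rw [integral_add h1 (hY.const_mul b), integral_add (integrable_const _) (hX.const_mul a),
    integral_const_mul, integral_const_mul]
  simp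

lemma measureReal_le_sum_le_exp {Z : Fin N → Ω → ℝ} (hm : ∀ i, Measurable (Z i))
    (hind : iIndepFun Z μ) {c : ℝ} (hint : ∀ i, Integrable (fun ω => Real.exp (Z i ω)) μ)
    (hc : ∀ i, ∫ ω, Real.exp (Z i ω) ∂μ ≤ Real.exp c) (u : ℝ) :
    μ.real {ω | N * u ≤ ∑ i, Z i ω} ≤ Real.exp (N * (c - u)) := by
  have h1 := measure_ge_le_exp_mul_mgf (μ := μ) (X := ∑ i, Z i) (t := 1) (N * u) zero_le_one
    (hind.integrable_exp_mul_sum hm (s := Finset.univ) (by simpa using hint))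
  rw [hind.mgf_sum hm] at h1
  have h2 : ∏ i : Fin N, mgf (Z i) μ 1 ≤ Real.exp (N * c) := by
    calc ∏ i : Fin N, mgf (Z i) μ 1 ≤ ∏ _i : Fin N, Real.exp c :=
          Finset.prod_le_prod (fun i _ => mgf_nonneg) (fun i _ => by simpa [mgf] using hc i)
      _ = Real.exp (N * c) := by simp [Real.exp_nat_mul]
  simp only [Finset.sum_apply] at h1
  refine h1.trans ?_
  calc _ ≤ Real.exp (-1 * (N * u)) * Real.exp (N * c) := by gcongr
    _ = _ := by rw [← Real.exp_add]; ring_nf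

/-- A one-sided Bernstein type bound. The hypothesis `E Z² e^{s|Z|} ≤ V` at the single value `s`
of the Chernoff parameter replaces boundedness or moment growth conditions; it concerns the
variables before they are shifted by `m`. -/
lemma measureReal_mean_ge_le {Z : Fin N → Ω → ℝ} (hN : 1 ≤ N) (hm : ∀ i, Measurable (Z i))
    (hind : iIndepFun Z μ) {s V β : ℝ} {m : Fin N → ℝ} (hs : 0 < s) (hZ : ∀ i, Integrable (Z i) μ)
    (hint : ∀ i, Integrable (fun ω => Z i ω ^ 2 * Real.exp (s * |Z i ω|)) μ)
    (hV : ∀ i, ∫ ω, Z i ω ^ 2 * Real.exp (s * |Z i ω|) ∂μ ≤ V)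
    (hβ : ∀ i, ∫ ω, Z i ω ∂μ - m i ≤ β) (u : ℝ) :
    μ.real {ω | u ≤ (N : ℝ)⁻¹ * ∑ i, (Z i ω - m i)} ≤
      Real.exp (-(N * (s * u - s * β - s ^ 2 * V))) := by
  have hgi : ∀ i, Integrable (fun ω => 1 + s * Z i ω +
      s ^ 2 * (Z i ω ^ 2 * Real.exp (s * |Z i ω|))) μ := fun i =>
    ((integrable_const _).add ((hZ i).const_mul s)).add ((hint i).const_mul _)
  have key : ∀ i, Integrable (fun ω => Real.exp (s * Z i ω)) μ ∧
      ∫ ω, Real.exp (s * Z i ω) ∂μ ≤ ∫ ω, (1 + s * Z i ω +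
        s ^ 2 * (Z i ω ^ 2 * Real.exp (s * |Z i ω|))) ∂μ := fun i => by
    refine integrable_and_integral_le (by have := hm i; fun_prop) (hgi i)
      (fun ω => (Real.exp_pos _).le) (fun ω => ?_)
    have h := exp_le_one_add_add_sq_mul (s * Z i ω)
    rw [abs_mul, abs_of_pos hs, mul_pow] at h
    linarith
  have hexp : ∀ i ω, Real.exp (s * (Z i ω - m i)) =
      Real.exp (-(s * m i)) * Real.exp (s * Z i ω) := fun i ω => by
    rw [← Real.exp_add]; congr 1; ring
  have hc : ∀ i, ∫ ω, Real.exp (s * (Z i ω - m i)) ∂μ ≤ Real.exp (s * β + s ^ 2 * V) := fun i => by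
    simp only [hexp]
    rw [integral_const_mul]
    have h0 : ∫ ω, Real.exp (s * Z i ω) ∂μ ≤ Real.exp (s * ∫ ω, Z i ω ∂μ + s ^ 2 * V) := by
      refine (key i).2.trans ?_
      rw [integral_one_add_mul_add_mul (hZ i) (hint i)]
      have h2 := mul_le_mul_of_nonneg_left (hV i) (sq_nonneg s)
      linarith [Real.add_one_le_exp (s * ∫ ω, Z i ω ∂μ + s ^ 2 * V)]
    refine (mul_le_mul_of_nonneg_left h0 (Real.exp_pos _).le).trans ?_
    rw [← Real.exp_add]
    have h1 := mul_le_mul_of_nonneg_left (hβ i) hs.le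
    exact Real.exp_le_exp.2 (by linarith)
  have h := measureReal_le_sum_le_exp (Z := fun i ω => s * (Z i ω - m i))
    (fun i => ((hm i).sub_const _).const_mul s)
    (hind.comp (fun i z => s * (z - m i)) (fun i => by fun_prop))
    (fun i => by simp only [hexp]; exact (key i).1.const_mul _) hc (s * u)
  have hN' : (0 : ℝ) < N := by exact_mod_cast hN
  refine (measureReal_mono fun ω hω => ?_).trans (h.trans (le_of_eq ?_))
  · simp only [Set.mem_ofPred_eq] at hω ⊢
    rw [inv_mul_eq_div, le_div_iff₀ hN'] at hω
    rw [← Finset.mul_sum]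
    nlinarith
  · congr 1; ring

lemma measureReal_abs_mean_ge_le {Z : Fin N → Ω → ℝ} (hN : 1 ≤ N) (hm : ∀ i, Measurable (Z i))
    (hind : iIndepFun Z μ) {s V β : ℝ} {m : Fin N → ℝ} (hs : 0 < s) (hZ : ∀ i, Integrable (Z i) μ)
    (hint : ∀ i, Integrable (fun ω => Z i ω ^ 2 * Real.exp (s * |Z i ω|)) μ)
    (hV : ∀ i, ∫ ω, Z i ω ^ 2 * Real.exp (s * |Z i ω|) ∂μ ≤ V)
    (hβ : ∀ i, |∫ ω, Z i ω ∂μ - m i| ≤ β) (u : ℝ) :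
    μ.real {ω | u ≤ |(N : ℝ)⁻¹ * ∑ i, (Z i ω - m i)|} ≤
      2 * Real.exp (-(N * (s * u - s * β - s ^ 2 * V))) := by
  have h1 := measureReal_mean_ge_le hN hm hind hs hZ hint hV (fun i => (abs_le.1 (hβ i)).2) u
  have h2 := measureReal_mean_ge_le (Z := fun i ω => - Z i ω) (m := fun i => - m i) (β := β) hN
    (fun i => (hm i).neg)
    (hind.comp (fun _ z => -z) (fun _ => measurable_neg)) hs (fun i => (hZ i).neg)
    (by simpa using hint) (by simpa using hV)
    (fun i => by rw [integral_neg]; linarith [(abs_le.1 (hβ i)).1]) u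
  have e : ∀ ω, ∑ i, (- Z i ω - - m i) = - ∑ i, (Z i ω - m i) := fun ω => by
    rw [← Finset.sum_neg_distrib]; exact Finset.sum_congr rfl fun i _ => by ring
  simp only [e] at h2
  calc _ ≤ μ.real ({ω | u ≤ (N : ℝ)⁻¹ * ∑ i, (Z i ω - m i)} ∪
        {ω | u ≤ (N : ℝ)⁻¹ * -∑ i, (Z i ω - m i)}) := by
        refine measureReal_mono fun ω hω => ?_
        simpa only [Set.mem_union, Set.mem_ofPred_eq, mul_neg, le_abs] using hω
    _ ≤ _ := (measureReal_union_le _ _).trans (by linarith)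

/-- The lower tail of an average of nonnegative variables only needs second moments. -/
lemma measureReal_mean_le_half_le {W : Fin N → Ω → ℝ} (hN : 1 ≤ N) (hm : ∀ i, Measurable (W i))
    (hind : iIndepFun W μ) {κ K : ℝ} (hκ : 0 < κ) (hK : 0 < K) (h0 : ∀ i ω, 0 ≤ W i ω)
    (hW : ∀ i, Integrable (W i) μ) (hW2 : ∀ i, Integrable (fun ω => W i ω ^ 2) μ)
    (hmean : ∀ i, κ ≤ ∫ ω, W i ω ∂μ) (hsq : ∀ i, ∫ ω, W i ω ^ 2 ∂μ ≤ K) :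
    μ.real {ω | (N : ℝ)⁻¹ * ∑ i, W i ω ≤ κ / 2} ≤ Real.exp (-(N * (κ ^ 2 / (16 * K)))) := by
  -- the optimal Chernoff parameter for the exponent `-tκ/2 + t²K`
  set t : ℝ := κ / (4 * K) with ht
  have htpos : 0 < t := by positivity
  have key : ∀ i, Integrable (fun ω => Real.exp (-t * W i ω)) μ ∧
      ∫ ω, Real.exp (-t * W i ω) ∂μ ≤ ∫ ω, (1 + -t * W i ω + t ^ 2 * W i ω ^ 2) ∂μ := fun i => by
    refine integrable_and_integral_le (by have := hm i; fun_prop)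
      (((integrable_const _).add ((hW i).const_mul (-t))).add ((hW2 i).const_mul _))
      (fun ω => (Real.exp_pos _).le) (fun ω => ?_)
    have h := exp_neg_le_one_sub_add_sq (mul_nonneg htpos.le (h0 i ω))
    rw [mul_pow] at h
    rw [neg_mul]
    linarith
  have hc : ∀ i, ∫ ω, Real.exp (-t * W i ω) ∂μ ≤ Real.exp (-t * κ + t ^ 2 * K) := fun i => by
    refine (key i).2.trans ?_
    rw [integral_one_add_mul_add_mul (hW i) (hW2 i)]
    have h1 := mul_le_mul_of_nonneg_left (hmean i) htpos.le
    have h2 := mul_le_mul_of_nonneg_left (hsq i) (sq_nonneg t)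
    linarith [Real.add_one_le_exp (-t * κ + t ^ 2 * K)]
  have h := measureReal_le_sum_le_exp (Z := fun i ω => -t * W i ω)
    (fun i => (hm i).const_mul _)
    (hind.comp (fun _ z => -t * z) (fun _ => measurable_const_mul _)) (fun i => (key i).1) hc
    (-t * (κ / 2))
  have hN' : (0 : ℝ) < N := by exact_mod_cast hN
  refine (measureReal_mono fun ω hω => ?_).trans (h.trans (le_of_eq ?_))
  · simp only [Set.mem_ofPred_eq] at hω ⊢
    rw [inv_mul_eq_div, div_le_iff₀ hN'] at hω
    rw [← Finset.mul_sum]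
    nlinarith
  · congr 1; rw [ht]; field_simp; ring

/-- The upper tail of an average of variables with `E e^W ≤ 2`. -/
lemma measureReal_mean_ge_le_of_exp {W : Fin N → Ω → ℝ} (hN : 1 ≤ N)
    (hm : ∀ i, Measurable (W i)) (hind : iIndepFun W μ)
    (hi : ∀ i, Integrable (fun ω => Real.exp (W i ω)) μ)
    (h2 : ∀ i, ∫ ω, Real.exp (W i ω) ∂μ ≤ 2) :
    μ.real {ω | 2 ≤ (N : ℝ)⁻¹ * ∑ i, W i ω} ≤ Real.exp (-N) := by
  have h := measureReal_le_sum_le_exp hm hind (c := 1) hi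
    (fun i => (h2 i).trans (by linarith [Real.add_one_le_exp (1 : ℝ)])) 2
  have hN' : (0 : ℝ) < N := by exact_mod_cast hN
  refine (measureReal_mono fun ω hω => ?_).trans (h.trans (le_of_eq ?_))
  · simp only [Set.mem_ofPred_eq] at hω ⊢
    rw [inv_mul_eq_div, le_div_iff₀ hN'] at hω
    linarith
  · congr 1; ring

end Chernoff

/-! ### Vectors and sample covariance matrices -/

section Deterministic

variable {d N : ℕ}

lemma l1Norm_nonneg (v : Fin d → ℝ) : 0 ≤ l1Norm v :=
  Finset.sum_nonneg fun _ _ => abs_nonneg _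

lemma l2Norm_nonneg (v : Fin d → ℝ) : 0 ≤ l2Norm v := Real.sqrt_nonneg _

lemma l2Norm_sq (v : Fin d → ℝ) : l2Norm v ^ 2 = ∑ j, v j ^ 2 :=
  Real.sq_sqrt (Finset.sum_nonneg fun _ _ => sq_nonneg _)

lemma l2Norm_smul (c : ℝ) (v : Fin d → ℝ) : l2Norm (c • v) = |c| * l2Norm v := by
  simp only [l2Norm, Pi.smul_apply, smul_eq_mul, mul_pow, ← Finset.mul_sum]
  rw [Real.sqrt_mul (sq_nonneg c), Real.sqrt_sq_eq_abs]

lemma l2Norm_eq_zero {v : Fin d → ℝ} (h : l2Norm v = 0) : v = 0 := by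
  have h2 : ∑ j, v j ^ 2 = 0 := by rw [← l2Norm_sq, h]; simp
  funext j
  rw [Finset.sum_eq_zero_iff_of_nonneg fun _ _ => sq_nonneg _] at h2
  exact pow_eq_zero_iff two_ne_zero |>.1 (h2 j (Finset.mem_univ j))

lemma dotProduct_sampleCov_mulVec (X : Fin N → Fin d → ℝ) (v w : Fin d → ℝ) :
    v ⬝ᵥ (sampleCov X *ᵥ w) = (N : ℝ)⁻¹ * ∑ i, (v ⬝ᵥ X i) * (X i ⬝ᵥ w) := by
  rw [sampleCov, smul_mulVec, dotProduct_smul, smul_eq_mul, Matrix.sum_mulVec, dotProduct_sum]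
  congr 1
  refine Finset.sum_congr rfl fun i _ => ?_
  rw [vecMulVec_mulVec]
  simp [dotProduct_smul, mul_comm]

lemma sampleCov_comm (X : Fin N → Fin d → ℝ) (v w : Fin d → ℝ) :
    v ⬝ᵥ (sampleCov X *ᵥ w) = w ⬝ᵥ (sampleCov X *ᵥ v) := by
  rw [dotProduct_sampleCov_mulVec, dotProduct_sampleCov_mulVec]
  congr 1
  refine Finset.sum_congr rfl fun i _ => ?_
  rw [dotProduct_comm v, dotProduct_comm w, mul_comm]

lemma sampleCov_quadratic_nonneg (X : Fin N → Fin d → ℝ) (v : Fin d → ℝ) :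
    0 ≤ v ⬝ᵥ (sampleCov X *ᵥ v) := by
  rw [dotProduct_sampleCov_mulVec]
  refine mul_nonneg (by positivity) (Finset.sum_nonneg fun i _ => ?_)
  rw [dotProduct_comm v]; exact mul_self_nonneg _

lemma sampleCov_apply (X : Fin N → Fin d → ℝ) (j k : Fin d) :
    sampleCov X j k = (N : ℝ)⁻¹ * ∑ i, X i j * X i k := by
  simp [sampleCov, Matrix.sum_apply, vecMulVec_apply]

lemma crossCov_sub_sampleCov_apply (y : Fin N → ℝ) (X : Fin N → Fin d → ℝ) (θ : Fin d → ℝ)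
    (j : Fin d) : (crossCov y X - sampleCov X *ᵥ θ) j =
      (N : ℝ)⁻¹ * ∑ i, (y i * X i j - X i j * (X i ⬝ᵥ θ)) := by
  rw [Finset.sum_sub_distrib, mul_sub, Pi.sub_apply]
  congr 1
  · simp [crossCov, Finset.sum_apply]
  · have h := dotProduct_sampleCov_mulVec X (Pi.single j 1) θ
    simpa using h

lemma abs_dotProduct_le_norm_mul_l1Norm (u v : Fin d → ℝ) : |u ⬝ᵥ v| ≤ ‖u‖ * l1Norm v := by
  rw [dotProduct, l1Norm, Finset.mul_sum]
  refine (Finset.abs_sum_le_sum_abs _ _).trans (Finset.sum_le_sum fun j _ => ?_)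
  rw [abs_mul]
  exact mul_le_mul_of_nonneg_right (norm_le_pi_norm u j) (abs_nonneg _)

/-! ### The penalized estimator under a restricted lower bound on the sample covariance -/

lemma card_mul_rpow_le_lqSum {q s : ℝ} (hq : 0 ≤ q) (hs : 0 < s) (θ : Fin d → ℝ) :
    ((Finset.univ.filter fun j => s < |θ j|).card : ℝ) * s ^ q ≤ lqSum q θ := by
  rw [← nsmul_eq_mul, ← Finset.sum_const, lqSum]
  calc _ ≤ ∑ j ∈ Finset.univ.filter fun j => s < |θ j|, if θ j = 0 then 0 else |θ j| ^ q := by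
        refine Finset.sum_le_sum fun j hj => ?_
        have hj' := (Finset.mem_filter.1 hj).2
        have : θ j ≠ 0 := abs_pos.1 (hs.trans hj')
        rw [if_neg this]
        exact Real.rpow_le_rpow hs.le hj'.le hq
    _ ≤ _ := Finset.sum_le_sum_of_subset_of_nonneg (Finset.filter_subset _ _)
        fun j _ _ => by split_ifs <;> positivity

lemma sum_small_le_lqSum {q s : ℝ} (hq : q ≤ 1) (hs : 0 < s) (θ : Fin d → ℝ) :
    ∑ j ∈ Finset.univ.filter (fun j => ¬ s < |θ j|), |θ j| ≤ s ^ (1 - q) * lqSum q θ := by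
  rw [lqSum, Finset.mul_sum]
  calc _ ≤ ∑ j ∈ Finset.univ.filter (fun j => ¬ s < |θ j|),
        s ^ (1 - q) * (if θ j = 0 then 0 else |θ j| ^ q) := by
        refine Finset.sum_le_sum fun j hj => ?_
        have hj' := not_lt.1 (Finset.mem_filter.1 hj).2
        split_ifs with h0
        · simp [h0]
        · have hp := abs_pos.2 h0
          calc |θ j| = |θ j| ^ (1 - q) * |θ j| ^ q := by
                rw [← Real.rpow_add hp]; simp
            _ ≤ _ := by gcongr
    _ ≤ _ := Finset.sum_le_sum_of_subset_of_nonneg (Finset.filter_subset _ _)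
        fun j _ _ => by split_ifs <;> positivity

/-- The basic inequality for the penalized estimator, when the penalty dominates twice the
score. -/
lemma basic_inequality {y : Fin N → ℝ} {X : Fin N → Fin d → ℝ} {θ θhat : Fin d → ℝ} {t : ℝ}
    (hest : IsEstimate y X (2 * t) θhat) (hscore : scoreNorm y X θ ≤ t) :
    (θhat - θ) ⬝ᵥ (sampleCov X *ᵥ (θhat - θ)) ≤
      2 * t * (l1Norm (θhat - θ) + 2 * l1Norm θ - 2 * l1Norm θhat) := by
  have h := hest θ
  set Δ := θhat - θ with hΔ
  have hθ : θhat = θ + Δ := by simp [hΔ]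
  have h1 : (crossCov y X - sampleCov X *ᵥ θ) ⬝ᵥ Δ ≤ t * l1Norm Δ :=
    (le_abs_self _).trans ((abs_dotProduct_le_norm_mul_l1Norm _ _).trans
      (mul_le_mul_of_nonneg_right hscore (l1Norm_nonneg _)))
  rw [sub_dotProduct, dotProduct_comm (sampleCov X *ᵥ θ)] at h1
  have hsym := sampleCov_comm X θ Δ
  unfold penalizedLoss at h
  have e1 : crossCov y X ⬝ᵥ θhat = crossCov y X ⬝ᵥ θ + crossCov y X ⬝ᵥ Δ := by
    rw [hθ, dotProduct_add]
  have e2 : θhat ⬝ᵥ (sampleCov X *ᵥ θhat) = θ ⬝ᵥ (sampleCov X *ᵥ θ) +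
      θ ⬝ᵥ (sampleCov X *ᵥ Δ) + (Δ ⬝ᵥ (sampleCov X *ᵥ θ) + Δ ⬝ᵥ (sampleCov X *ᵥ Δ)) := by
    rw [hθ, mulVec_add, add_dotProduct, dotProduct_add, dotProduct_add]
  rw [e1, e2] at h
  linarith

/-- Comparison of `ℓ₁` norms, coordinate by coordinate, for an arbitrary set `S` of large
coordinates. -/
lemma l1Norm_add_sub_le (θ θhat : Fin d → ℝ) (p : Fin d → Prop) [DecidablePred p] :
    l1Norm (θhat - θ) + 2 * l1Norm θ - 2 * l1Norm θhat ≤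
      3 * ∑ j ∈ Finset.univ.filter p, |(θhat - θ) j| -
        ∑ j ∈ Finset.univ.filter (fun j => ¬ p j), |(θhat - θ) j| +
        4 * ∑ j ∈ Finset.univ.filter (fun j => ¬ p j), |θ j| := by
  simp only [l1Norm, Finset.sum_filter, Finset.mul_sum]
  rw [← Finset.sum_add_distrib, ← Finset.sum_sub_distrib, ← Finset.sum_sub_distrib,
    ← Finset.sum_add_distrib]
  refine Finset.sum_le_sum fun j _ => ?_
  have h1 := abs_sub_abs_le_abs_sub (θ j) (θhat j)
  have h2 := abs_sub (θhat j) (θ j)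
  rw [abs_sub_comm] at h1
  simp only [Pi.sub_apply]
  split_ifs <;> linarith

/-- The error bounds for the penalized estimator, with `W = ρ s^{-q}` playing the role of the
sparsity: if the penalty is at least twice the score and the sample covariance satisfies
`vᵀ Σ̂ v ≥ κ ‖v‖₂² - B ‖v‖₁²` with `B W` small compared with `κ`, then the squared `ℓ₂` error is
of order `W s²` and the `ℓ₁` error of order `W s`. The coordinates of `θ` are split at the
level `s`. -/
theorem estimate_error_le {y : Fin N → ℝ} {X : Fin N → Fin d → ℝ} {θ θhat : Fin d → ℝ}
    {q ρ s ν κ B : ℝ} (hs : 0 < s) (hν : 0 < ν) (hκ : 0 < κ) (hB : 0 ≤ B) (hq0 : 0 ≤ q)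
    (hq1 : q ≤ 1) (hρ : 0 < ρ) (hlq : lqSum q θ ≤ ρ)
    (hest : IsEstimate y X (2 * (ν * s)) θhat)
    (hscore : scoreNorm y X θ ≤ ν * s)
    (hrsc : ∀ v, κ * l2Norm v ^ 2 - B * l1Norm v ^ 2 ≤ v ⬝ᵥ (sampleCov X *ᵥ v))
    (hBW : B * (ρ * s ^ (-q)) ≤ κ / 64) :
    l2Norm (θhat - θ) ^ 2 ≤
        (2 + 144 * ν ^ 2 / κ ^ 2 + 32 * ν / κ) * (ρ * s ^ (-q) * s ^ 2) ∧
      l1Norm (θhat - θ) ≤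
        (4 * √(2 + 144 * ν ^ 2 / κ ^ 2 + 32 * ν / κ) + 4) * (ρ * s ^ (-q) * s) := by
  set W : ℝ := ρ * s ^ (-q) with hW
  set C : ℝ := 2 + 144 * ν ^ 2 / κ ^ 2 + 32 * ν / κ with hC
  have hWpos : 0 < W := by positivity
  have hCpos : 0 < C := by positivity
  set Δ := θhat - θ with hΔ
  set S := Finset.univ.filter fun j => s < |θ j| with hS
  set a := ∑ j ∈ S, |Δ j| with ha
  set b := ∑ j ∈ Finset.univ.filter (fun j => ¬ s < |θ j|), |Δ j| with hb
  set e := ∑ j ∈ Finset.univ.filter (fun j => ¬ s < |θ j|), |θ j| with he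
  set t := l2Norm Δ with ht
  have ht0 : 0 ≤ t := l2Norm_nonneg _
  have hcard : (S.card : ℝ) ≤ W := by
    have h1 := (card_mul_rpow_le_lqSum hq0 hs θ).trans hlq
    rw [hW, Real.rpow_neg hs.le, ← div_eq_mul_inv, le_div_iff₀ (by positivity)]
    exact h1
  have hesmall : e ≤ W * s := by
    refine (sum_small_le_lqSum hq1 hs θ).trans ?_
    calc s ^ (1 - q) * lqSum q θ ≤ s ^ (1 - q) * ρ := by gcongr
      _ = W * s := by
        rw [hW, sub_eq_neg_add, Real.rpow_add hs, Real.rpow_one]; ring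
  have hl1 : l1Norm Δ = a + b := by
    rw [l1Norm, ha, hb, hS, Finset.sum_filter_add_sum_filter_not]
  have ha2 : a ≤ √W * t := by
    have h1 : a ^ 2 ≤ W * t ^ 2 := by
      calc a ^ 2 ≤ S.card * ∑ j ∈ S, |Δ j| ^ 2 := sq_sum_le_card_mul_sum_sq
        _ ≤ W * ∑ j, |Δ j| ^ 2 := by
            gcongr
            exact Finset.subset_univ _
        _ = W * t ^ 2 := by rw [ht, l2Norm_sq]; simp
    rw [← Real.sqrt_sq ht0, ← Real.sqrt_mul hWpos.le]
    exact Real.le_sqrt_of_sq_le h1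
  have ha0 : 0 ≤ a := Finset.sum_nonneg fun _ _ => abs_nonneg _
  have hb0 : 0 ≤ b := Finset.sum_nonneg fun _ _ => abs_nonneg _
  have he0 : 0 ≤ e := Finset.sum_nonneg fun _ _ => abs_nonneg _
  have hbasic : Δ ⬝ᵥ (sampleCov X *ᵥ Δ) ≤ 2 * (ν * s) * (3 * a - b + 4 * e) :=
    (basic_inequality hest hscore).trans (by
      have := l1Norm_add_sub_le θ θhat (fun j => s < |θ j|)
      gcongr)
  have hνs : 0 < ν * s := by positivity
  have hcone : b ≤ 3 * a + 4 * e := by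
    have h := (sampleCov_quadratic_nonneg X Δ).trans hbasic
    have := nonneg_of_mul_nonneg_right h (by positivity)
    linarith
  set r := √W with hr
  have hr2 : r ^ 2 = W := Real.sq_sqrt hWpos.le
  have hr0 : 0 < r := Real.sqrt_pos.2 hWpos
  have hL : l1Norm Δ ≤ 4 * (r * t) + 4 * (W * s) := by rw [hl1]; linarith
  have hL2 : l1Norm Δ ^ 2 ≤ 32 * (W * t ^ 2) + 32 * (W * s) ^ 2 := by
    calc l1Norm Δ ^ 2 ≤ (4 * (r * t) + 4 * (W * s)) ^ 2 := by
          gcongr; exact l1Norm_nonneg _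
      _ ≤ 32 * (r ^ 2 * t ^ 2) + 32 * (W * s) ^ 2 := by
          nlinarith [sq_nonneg (r * t - W * s)]
      _ = _ := by rw [hr2]
  have hquad : κ * t ^ 2 ≤ κ / 2 * t ^ 2 + κ / 2 * (W * s ^ 2) +
      2 * (ν * s) * (3 * (r * t) + 4 * (W * s)) := by
    have h1 := hrsc Δ
    have h2 : B * l1Norm Δ ^ 2 ≤ κ / 2 * t ^ 2 + κ / 2 * (W * s ^ 2) := by
      calc B * l1Norm Δ ^ 2 ≤ B * (32 * (W * t ^ 2) + 32 * (W * s) ^ 2) := by gcongr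
        _ = (B * W) * (32 * (t ^ 2 + W * s ^ 2)) := by ring
        _ ≤ κ / 64 * (32 * (t ^ 2 + W * s ^ 2)) := by gcongr
        _ = _ := by ring
    have h3 : 2 * (ν * s) * (3 * a - b + 4 * e) ≤
        2 * (ν * s) * (3 * (r * t) + 4 * (W * s)) := by
      gcongr; linarith
    linarith
  have hmain : t ^ 2 ≤ C * (W * s ^ 2) := by
    -- absorb the linear term: `6 ν s r t ≤ κ t² / 4 + 36 ν² s² W / κ`
    have h1 : 6 * (ν * s) * (r * t) ≤ κ / 4 * t ^ 2 + 36 * ν ^ 2 / κ * (W * s ^ 2) := by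
      have h2 : 0 ≤ (κ / 2 * t - 6 * ν * s * r) ^ 2 / κ := by positivity
      have h3 : (κ / 2 * t - 6 * ν * s * r) ^ 2 / κ =
          κ / 4 * t ^ 2 - 6 * (ν * s) * (r * t) + 36 * ν ^ 2 / κ * (r ^ 2 * s ^ 2) := by
        field_simp; ring
      rw [h3, hr2] at h2
      linarith
    have h4 : κ / 4 * t ^ 2 ≤ (κ / 2 + 36 * ν ^ 2 / κ + 8 * ν) * (W * s ^ 2) := by nlinarith
    have h5 : (κ / 2 + 36 * ν ^ 2 / κ + 8 * ν) * (W * s ^ 2) = κ / 4 * (C * (W * s ^ 2)) := by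
      rw [hC]; field_simp; ring
    rw [h5] at h4
    exact le_of_mul_le_mul_left h4 (by positivity)
  refine ⟨hmain, hL.trans ?_⟩
  have h6 : t ≤ √C * (r * s) := by
    refine abs_le_of_sq_le_sq' ?_ (by positivity) |>.2
    rw [mul_pow, mul_pow, hr2, Real.sq_sqrt hCpos.le]
    exact hmain
  calc 4 * (r * t) + 4 * (W * s) ≤ 4 * (r * (√C * (r * s))) + 4 * (W * s) := by gcongr
    _ = 4 * √C * (r ^ 2 * s) + 4 * (W * s) := by ring
    _ = _ := by rw [hr2]; ring

end Deterministic

/-! ### From signed sums of basis vectors to all vectors -/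

section Sparsification

variable {d : ℕ}

open Classical in
/-- The finite set of all sums of `n` signed standard basis vectors `± e_j`, at most `(2d)^n`
vectors. -/
noncomputable def signedSums (d : ℕ) : ℕ → Finset (Fin d → ℝ)
  | 0 => {0}
  | n + 1 => (signedSums d n ×ˢ (Finset.univ : Finset (Fin d × Bool))).image
      fun p => p.1 + Pi.single p.2.1 (if p.2.2 then (1 : ℝ) else -1)

lemma card_signedSums_le (n : ℕ) : ((signedSums d n).card : ℝ) ≤ (2 * d : ℝ) ^ n := by
  induction n with
  | zero => simp [signedSums]
  | succ n ih =>
    have h : (signedSums d (n + 1)).card ≤ (signedSums d n).card * (d * 2) := by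
      rw [signedSums]
      refine Finset.card_image_le.trans (le_of_eq ?_)
      simp [Finset.card_product]
    calc ((signedSums d (n + 1)).card : ℝ) ≤ (signedSums d n).card * (d * 2) := by
          exact_mod_cast h
      _ ≤ (2 * d : ℝ) ^ n * (d * 2) := by gcongr
      _ = _ := by ring

lemma add_single_mem_signedSums {n : ℕ} {z : Fin d → ℝ} (hz : z ∈ signedSums d n) (j : Fin d)
    {c : ℝ} (hc : c = 1 ∨ c = -1) : z + Pi.single j c ∈ signedSums d (n + 1) := by
  rw [signedSums, Finset.mem_image]
  rcases hc with rfl | rfl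
  · exact ⟨(z, j, true), by simp [hz], by simp⟩
  · exact ⟨(z, j, false), by simp [hz], by simp⟩

/-- Maurey's empirical method as an induction. For a vector `v` with `‖v‖₁ = 1`, write `v` as the
mean of the random vector `sgn(v_j) e_j`, `j` drawn with probability `|v_j|`. If the quadratic form
of `A` is nonnegative on all sums of `n` signed basis vectors, then its expectation at `z` plus `i`
independent draws is nonnegative; the expectation is computed one draw at a time. -/
lemma expected_quadratic_nonneg {A : Matrix (Fin d) (Fin d) ℝ}
    (hsym : ∀ v w : Fin d → ℝ, v ⬝ᵥ (A *ᵥ w) = w ⬝ᵥ (A *ᵥ v)) {n : ℕ}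
    (hn : ∀ z ∈ signedSums d n, 0 ≤ z ⬝ᵥ (A *ᵥ z)) {v : Fin d → ℝ} (hv : l1Norm v = 1)
    (i : ℕ) : ∀ m, m + i = n → ∀ z ∈ signedSums d m,
      0 ≤ z ⬝ᵥ (A *ᵥ z) + 2 * i * (z ⬝ᵥ (A *ᵥ v)) + i * ∑ j, |v j| * A j j +
        i * (i - 1) * (v ⬝ᵥ (A *ᵥ v)) := by
  induction i with
  | zero => intro m hm z hz; simpa using hn z (by simpa [← hm] using hz)
  | succ i ih =>
    intro m hm z hz
    set σ : Fin d → ℝ := fun j => if 0 ≤ v j then 1 else -1 with hσ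
    have hσ1 : ∀ j, σ j = 1 ∨ σ j = -1 := fun j => by simp only [hσ]; split_ifs <;> simp
    have hσ2 : ∀ j, σ j * σ j = 1 := fun j => by rcases hσ1 j with h | h <;> rw [h] <;> norm_num
    have hσv : ∀ j, |v j| * σ j = v j := fun j => by
      simp only [hσ]
      split_ifs with h
      · rw [abs_of_nonneg h, mul_one]
      · rw [abs_of_neg (not_le.1 h)]; ring
    have key : 0 ≤ ∑ j, |v j| * ((z + Pi.single j (σ j)) ⬝ᵥ (A *ᵥ (z + Pi.single j (σ j))) +
        2 * i * ((z + Pi.single j (σ j)) ⬝ᵥ (A *ᵥ v)) + i * ∑ j, |v j| * A j j +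
        i * (i - 1) * (v ⬝ᵥ (A *ᵥ v))) :=
      Finset.sum_nonneg fun j _ => mul_nonneg (abs_nonneg _)
        (ih (m + 1) (by omega) _ (add_single_mem_signedSums hz j (hσ1 j)))
    have hexp : ∀ j, |v j| * ((z + Pi.single j (σ j)) ⬝ᵥ (A *ᵥ (z + Pi.single j (σ j))) +
        2 * i * ((z + Pi.single j (σ j)) ⬝ᵥ (A *ᵥ v)) + i * ∑ j, |v j| * A j j +
        i * (i - 1) * (v ⬝ᵥ (A *ᵥ v))) =
        |v j| * (z ⬝ᵥ (A *ᵥ z) + 2 * i * (z ⬝ᵥ (A *ᵥ v)) + i * ∑ j, |v j| * A j j +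
          i * (i - 1) * (v ⬝ᵥ (A *ᵥ v))) + 2 * (v j * (A *ᵥ z) j) + |v j| * A j j +
          2 * i * (v j * (A *ᵥ v) j) := fun j => by
      have h1 : (Pi.single j (σ j) : Fin d → ℝ) ⬝ᵥ (A *ᵥ Pi.single j (σ j)) = A j j := by
        rw [single_dotProduct, mulVec_single]
        simp only [Pi.smul_apply, Matrix.col_apply, MulOpposite.smul_eq_mul_unop,
          MulOpposite.unop_op]
        rw [mul_comm (A j j), ← mul_assoc, hσ2, one_mul]
      have h2 : z ⬝ᵥ (A *ᵥ Pi.single j (σ j)) = σ j * (A *ᵥ z) j := by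
        rw [hsym, single_dotProduct]
      rw [mulVec_add, add_dotProduct, dotProduct_add, dotProduct_add, add_dotProduct, h1, h2,
        single_dotProduct, single_dotProduct]
      linear_combination (2 * (A *ᵥ z) j + 2 * i * (A *ᵥ v) j) * hσv j
    simp only [hexp] at key
    rw [Finset.sum_add_distrib, Finset.sum_add_distrib, Finset.sum_add_distrib, ← Finset.sum_mul,
      ← Finset.mul_sum, ← Finset.mul_sum] at key
    have hv' : ∑ j, |v j| = 1 := hv
    have e1 : ∑ j, v j * (A *ᵥ z) j = z ⬝ᵥ (A *ᵥ v) := by rw [hsym]; rfl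
    have e2 : ∑ j, v j * (A *ᵥ v) j = v ⬝ᵥ (A *ᵥ v) := rfl
    rw [hv', e1, e2] at key
    push_cast
    linarith

/-- The transfer principle: a symmetric quadratic form that is nonnegative on sums of `n` signed
basis vectors, with diagonal at most `U`, is bounded below by `- U ‖v‖₁² / (n - 1)`. -/
lemma quadratic_ge_of_signedSums {A : Matrix (Fin d) (Fin d) ℝ}
    (hsym : ∀ v w : Fin d → ℝ, v ⬝ᵥ (A *ᵥ w) = w ⬝ᵥ (A *ᵥ v)) {n : ℕ} (hn2 : 2 ≤ n)
    (hn : ∀ z ∈ signedSums d n, 0 ≤ z ⬝ᵥ (A *ᵥ z)) {U : ℝ} (hU : ∀ j, A j j ≤ U)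
    (v : Fin d → ℝ) : -(U / (n - 1) * l1Norm v ^ 2) ≤ v ⬝ᵥ (A *ᵥ v) := by
  rcases (l1Norm_nonneg v).eq_or_lt with h0 | hpos
  · have : v = 0 := by
      funext j
      have := (Finset.sum_eq_zero_iff_of_nonneg (fun j _ => abs_nonneg (v j))).1 h0.symm
      simpa using this j (Finset.mem_univ j)
    simp [this, l1Norm]
  have hn1 : (0 : ℝ) < n - 1 := by
    have : (2 : ℝ) ≤ n := by exact_mod_cast hn2
    linarith
  have hn0 : (0 : ℝ) < n := by linarith
  set P := l1Norm v with hP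
  have hw : l1Norm (P⁻¹ • v) = 1 := by
    simp only [l1Norm, Pi.smul_apply, smul_eq_mul, abs_mul, ← Finset.mul_sum]
    rw [abs_of_pos (inv_pos.2 hpos)]
    exact inv_mul_cancel₀ hpos.ne'
  have h := expected_quadratic_nonneg hsym hn hw n 0 (by simp) 0 (by simp [signedSums])
  have hD : ∑ j, |(P⁻¹ • v) j| * A j j ≤ U := by
    calc _ ≤ ∑ j, |(P⁻¹ • v) j| * U := by gcongr with j; exact hU j
      _ = U := by rw [← Finset.sum_mul]; rw [show ∑ j, |(P⁻¹ • v) j| = 1 from hw, one_mul]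
  simp only [zero_dotProduct, mul_zero, zero_add] at h
  rw [mul_assoc, ← mul_add] at h
  have h' := nonneg_of_mul_nonneg_right h hn0
  rw [mulVec_smul, smul_dotProduct, dotProduct_smul, smul_eq_mul, smul_eq_mul] at h'
  have h2 : 0 ≤ U + (n - 1) * (P⁻¹ * (P⁻¹ * (v ⬝ᵥ (A *ᵥ v)))) := by linarith
  have h3 : U / (n - 1) * P ^ 2 + v ⬝ᵥ (A *ᵥ v) =
      P ^ 2 / (n - 1) * (U + (n - 1) * (P⁻¹ * (P⁻¹ * (v ⬝ᵥ (A *ᵥ v))))) := by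
    field_simp
  have h4 : 0 ≤ P ^ 2 / (n - 1) * (U + (n - 1) * (P⁻¹ * (P⁻¹ * (v ⬝ᵥ (A *ᵥ v))))) := by positivity
  linarith

end Sparsification

/-! ### Eigenvalues and second moments -/

lemma MinEigenvalueGE.le_quadratic {d : ℕ} {A : Matrix (Fin d) (Fin d) ℝ} {κ : ℝ}
    (h : MinEigenvalueGE A κ) (hA : A.IsHermitian) (v : Fin d → ℝ) :
    κ * l2Norm v ^ 2 ≤ v ⬝ᵥ (A *ᵥ v) := by
  have hB : (A - κ • (1 : Matrix (Fin d) (Fin d) ℝ)).IsHermitian := by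
    refine hA.sub ?_
    rw [Matrix.IsHermitian, conjTranspose_smul, conjTranspose_one, star_trivial]
  have hpsd : (A - κ • (1 : Matrix (Fin d) (Fin d) ℝ)).PosSemidef := by
    rw [hB.posSemidef_iff_eigenvalues_nonneg]
    intro i
    have hne : (hB.eigenvectorBasis i).ofLp ≠ 0 := by
      intro h0
      exact hB.eigenvectorBasis.orthonormal.ne_zero i (by ext j; simpa using congrFun h0 j)
    have h1 := hB.mulVec_eigenvectorBasis i
    rw [sub_mulVec, smul_mulVec, one_mulVec, sub_eq_iff_eq_add, ← add_smul] at h1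
    have h2 := h (hB.eigenvalues i + κ)
      (Module.End.hasEigenvalue_of_hasEigenvector
        ⟨Module.End.mem_eigenspace_iff.2 (by rw [toLin'_apply]; exact h1), hne⟩)
    simpa using h2
  have h3 := hpsd.dotProduct_mulVec_nonneg v
  rw [star_trivial, sub_mulVec, smul_mulVec, one_mulVec, dotProduct_sub, dotProduct_smul] at h3
  have h4 : v ⬝ᵥ v = l2Norm v ^ 2 := by
    rw [l2Norm_sq]; exact Finset.sum_congr rfl fun j _ => (sq (v j)).symm
  rw [h4, smul_eq_mul] at h3
  linarith

section SecondMoment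

variable {Ω : Type*} [MeasurableSpace Ω] {μ : Measure Ω} {d : ℕ}

lemma secondMoment_isHermitian (X : Ω → Fin d → ℝ) : (secondMoment μ X).IsHermitian := by
  ext j k
  simp [secondMoment, mul_comm]

lemma integral_mul_dotProduct {X : Ω → Fin d → ℝ} (h : ∀ j k, Integrable (fun ω => X ω j * X ω k) μ)
    (v : Fin d → ℝ) (j : Fin d) :
    ∫ ω, X ω j * (X ω ⬝ᵥ v) ∂μ = (secondMoment μ X *ᵥ v) j := by
  simp only [dotProduct, mulVec, secondMoment, Matrix.of_apply, Finset.mul_sum, ← mul_assoc]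
  rw [integral_finsetSum _ fun k _ => (h j k).mul_const _]
  simp [integral_mul_const]

lemma integral_dotProduct_sq {X : Ω → Fin d → ℝ} (h : ∀ j k, Integrable (fun ω => X ω j * X ω k) μ)
    (v : Fin d → ℝ) :
    ∫ ω, (v ⬝ᵥ X ω) ^ 2 ∂μ = v ⬝ᵥ (secondMoment μ X *ᵥ v) := by
  have h1 : ∀ j, Integrable (fun ω => X ω j * (X ω ⬝ᵥ v)) μ := fun j => by
    simp only [dotProduct, Finset.mul_sum, ← mul_assoc]
    exact integrable_finsetSum _ fun k _ => (h j k).mul_const _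
  have h2 : ∀ ω, (v ⬝ᵥ X ω) ^ 2 = ∑ j, v j * (X ω j * (X ω ⬝ᵥ v)) := fun ω => by
    rw [sq]; nth_rewrite 2 [dotProduct_comm]
    rw [dotProduct, Finset.sum_mul]
    exact Finset.sum_congr rfl fun j _ => by ring
  simp only [h2]
  rw [integral_finsetSum _ fun j _ => (h1 j).const_mul _]
  simp only [integral_const_mul, integral_mul_dotProduct h]
  rfl

end SecondMoment

/-! ### Moments and sub-Gaussian variables -/

section Moments

variable {Ω : Type*} [MeasurableSpace Ω] {μ : Measure Ω}

lemma integrable_and_integral_le_of_lintegral {f : Ω → ℝ} (hf : Measurable f)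
    (h0 : ∀ ω, 0 ≤ f ω) {M : ℝ} (hM : 0 ≤ M)
    (h : ∫⁻ ω, ENNReal.ofReal (f ω) ∂μ ≤ ENNReal.ofReal M) :
    Integrable f μ ∧ ∫ ω, f ω ∂μ ≤ M := by
  have hi : Integrable f μ := by
    refine ⟨hf.aestronglyMeasurable, ?_⟩
    rw [hasFiniteIntegral_iff_ofReal (Filter.Eventually.of_forall h0)]
    exact h.trans_lt ENNReal.ofReal_lt_top
  refine ⟨hi, ?_⟩
  rw [integral_eq_lintegral_of_nonneg_ae (Filter.Eventually.of_forall h0) hf.aestronglyMeasurable]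
  exact ENNReal.toReal_le_of_le_ofReal hM h

lemma absMoment_integrable {p M : ℝ} (hM : 0 ≤ M) {X : Ω → ℝ} (hX : Measurable X)
    (h : absMoment μ p X ≤ ENNReal.ofReal M) :
    Integrable (fun ω => |X ω| ^ p) μ ∧ ∫ ω, |X ω| ^ p ∂μ ≤ M :=
  integrable_and_integral_le_of_lintegral
    ((continuous_abs.measurable.comp hX).pow_const p) (fun _ => Real.rpow_nonneg (abs_nonneg _) p) hM h

/-- The even moments of a sub-Gaussian variable. -/
lemma lintegral_sq_pow_le_of_psi2Norm_le {X : Ω → ℝ} {κ : ℝ} (hκ : 0 < κ)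
    (h : psi2Norm μ X ≤ ENNReal.ofReal κ) {n : ℕ} (hn : 1 ≤ n) :
    ∫⁻ ω, ENNReal.ofReal ((X ω ^ 2) ^ n) ∂μ ≤ ENNReal.ofReal ((2 * κ ^ 2 * n) ^ n) := by
  have hn' : (1 : ℝ) ≤ n := by exact_mod_cast hn
  set p : ℝ := 2 * n with hp
  have hp1 : 1 ≤ p := by linarith
  have hp0 : 0 < p := by linarith
  have h1 : eLpNorm X (ENNReal.ofReal p) μ / ENNReal.ofReal (√p) ≤ ENNReal.ofReal κ :=
    (le_iSup₂ (f := fun (p : ℝ) (_ : 1 ≤ p) =>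
      eLpNorm X (ENNReal.ofReal p) μ / ENNReal.ofReal (√p)) p hp1).trans h
  rw [ENNReal.div_le_iff (by simpa using hp0) ENNReal.ofReal_ne_top,
    ← ENNReal.ofReal_mul hκ.le,
    eLpNorm_eq_lintegral_rpow_enorm_toReal (by simpa using hp0) ENNReal.ofReal_ne_top,
    ENNReal.toReal_ofReal hp0.le, one_div, ENNReal.rpow_inv_le_iff hp0,
    ENNReal.ofReal_rpow_of_nonneg (by positivity) hp0.le] at h1
  have h2 : (κ * √p) ^ p = (2 * κ ^ 2 * n) ^ n := by
    rw [hp, Real.rpow_mul (by positivity), Real.rpow_natCast]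
    congr 1
    rw [Real.rpow_two, mul_pow, Real.sq_sqrt (by positivity)]; ring
  rw [h2] at h1
  refine le_trans (le_of_eq (lintegral_congr fun ω => ?_)) h1
  rw [Real.enorm_eq_ofReal_abs, ENNReal.ofReal_rpow_of_nonneg (abs_nonneg _) hp0.le, hp,
    Real.rpow_mul (abs_nonneg _), Real.rpow_natCast, Real.rpow_two, sq_abs]

/-- A sub-Gaussian variable has `E exp (c X²) ≤ 2` for `c = 1 / (4 e κ²)`: expand the exponential
and use `n ^ n / n! ≤ e ^ n`. -/
lemma exp_sq_of_psi2Norm_le [IsProbabilityMeasure μ] {X : Ω → ℝ} (hX : Measurable X) {κ : ℝ}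
    (hκ : 0 < κ) (h : psi2Norm μ X ≤ ENNReal.ofReal κ) :
    Integrable (fun ω => Real.exp ((4 * Real.exp 1 * κ ^ 2)⁻¹ * X ω ^ 2)) μ ∧
      ∫ ω, Real.exp ((4 * Real.exp 1 * κ ^ 2)⁻¹ * X ω ^ 2) ∂μ ≤ 2 := by
  set c : ℝ := (4 * Real.exp 1 * κ ^ 2)⁻¹ with hc
  have hcpos : 0 < c := by positivity
  refine integrable_and_integral_le_of_lintegral (by fun_prop) (fun ω => (Real.exp_pos _).le)
    zero_le_two ?_
  have hsum : ∀ ω, ENNReal.ofReal (Real.exp (c * X ω ^ 2)) =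
      ∑' n : ℕ, ENNReal.ofReal ((c * X ω ^ 2) ^ n / n.factorial) := fun ω => by
    rw [← ENNReal.ofReal_tsum_of_nonneg (fun n => by positivity)
      (Real.summable_pow_div_factorial _), Real.exp_eq_exp_ℝ, NormedSpace.exp_eq_tsum_div]
  simp only [hsum]
  rw [lintegral_tsum fun n => by fun_prop]
  have hterm : ∀ n : ℕ, ∫⁻ ω, ENNReal.ofReal ((c * X ω ^ 2) ^ n / n.factorial) ∂μ ≤
      ENNReal.ofReal ((1 / 2) ^ n) := fun n => by
    rcases Nat.eq_zero_or_pos n with rfl | hn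
    · simp
    have e : ∀ ω, ENNReal.ofReal ((c * X ω ^ 2) ^ n / n.factorial) =
        ENNReal.ofReal (c ^ n / n.factorial) * ENNReal.ofReal ((X ω ^ 2) ^ n) := fun ω => by
      rw [← ENNReal.ofReal_mul (by positivity), mul_pow]; congr 1; ring
    simp only [e]
    rw [lintegral_const_mul _ (by fun_prop)]
    refine (mul_le_mul_right (lintegral_sq_pow_le_of_psi2Norm_le hκ h hn) _).trans ?_
    rw [← ENNReal.ofReal_mul (by positivity)]
    refine ENNReal.ofReal_le_ofReal ?_
    have h1 : (n : ℝ) ^ n / n.factorial ≤ Real.exp 1 ^ n := by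
      rw [← Real.exp_nat_mul, mul_one]
      exact Real.pow_div_factorial_le_exp n (Nat.cast_nonneg n) n
    calc c ^ n / n.factorial * (2 * κ ^ 2 * n) ^ n
        = (c * (2 * κ ^ 2)) ^ n * ((n : ℝ) ^ n / n.factorial) := by
          rw [mul_pow, mul_pow c]; ring
      _ ≤ (c * (2 * κ ^ 2)) ^ n * Real.exp 1 ^ n := by gcongr
      _ = (1 / 2) ^ n := by
          rw [← mul_pow]; congr 1; rw [hc]; field_simp; norm_num
  refine (ENNReal.tsum_le_tsum hterm).trans (le_of_eq ?_)
  rw [← ENNReal.ofReal_tsum_of_nonneg (fun n => by positivity) summable_geometric_two,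
    tsum_geometric_two]

lemma exp_dotProduct_sq_of_psi2NormVec_le [IsProbabilityMeasure μ] {d : ℕ} {X : Ω → Fin d → ℝ}
    (hX : Measurable X) {κ r : ℝ} (hκ : 0 < κ) (hr : 0 < r)
    (h : psi2NormVec μ X ≤ ENNReal.ofReal κ) {v : Fin d → ℝ} (hv : l2Norm v ≤ r) :
    Integrable (fun ω => Real.exp ((4 * Real.exp 1 * κ ^ 2 * r ^ 2)⁻¹ * (v ⬝ᵥ X ω) ^ 2)) μ ∧
      ∫ ω, Real.exp ((4 * Real.exp 1 * κ ^ 2 * r ^ 2)⁻¹ * (v ⬝ᵥ X ω) ^ 2) ∂μ ≤ 2 := by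
  have hmeas : ∀ w : Fin d → ℝ, Measurable fun ω => w ⬝ᵥ X ω := fun w => by
    simp only [dotProduct]; fun_prop
  rcases (l2Norm_nonneg v).eq_or_lt with h0 | hpos
  · simp [l2Norm_eq_zero h0.symm]
  set u := (l2Norm v)⁻¹ • v with hu
  have hu1 : l2Norm u = 1 := by
    rw [hu, l2Norm_smul, abs_of_pos (inv_pos.2 hpos), inv_mul_cancel₀ hpos.ne']
  have hψ : psi2Norm μ (fun ω => u ⬝ᵥ X ω) ≤ ENNReal.ofReal κ :=
    (le_iSup₂ (f := fun (v : Fin d → ℝ) (_ : l2Norm v = 1) =>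
      psi2Norm μ (fun ω => v ⬝ᵥ X ω)) u hu1).trans h
  have h1 := exp_sq_of_psi2Norm_le (hmeas u) hκ hψ
  have h2 := integrable_and_integral_le (μ := μ)
    (f := fun ω => Real.exp ((4 * Real.exp 1 * κ ^ 2 * r ^ 2)⁻¹ * (v ⬝ᵥ X ω) ^ 2))
    (by have := hmeas v; fun_prop) h1.1 (fun ω => (Real.exp_pos _).le) (fun ω => by
      have e : v ⬝ᵥ X ω = l2Norm v * (u ⬝ᵥ X ω) := by
        rw [hu, smul_dotProduct, smul_eq_mul, mul_inv_cancel_left₀ hpos.ne']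
      rw [e, mul_pow, mul_inv]
      refine Real.exp_le_exp.2 ?_
      rw [mul_assoc]
      refine mul_le_mul_of_nonneg_left ?_ (by positivity)
      rw [← mul_assoc]
      refine mul_le_of_le_one_left (sq_nonneg _) ?_
      rw [inv_mul_le_one₀ (by positivity)]
      gcongr)
  exact ⟨h2.1, h2.2.trans h1.2⟩

/-! ### Truncation -/

lemma trunc_eq {τ : ℝ} (hτ : 0 ≤ τ) (y : ℝ) : trunc τ y = max (-τ) (min y τ) := by
  unfold trunc
  rcases lt_trichotomy y 0 with h | rfl | h
  · rw [Real.sign_of_neg h, abs_of_neg h, min_eq_left (h.le.trans hτ)]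
    rcases le_total (-y) τ with h1 | h1
    · rw [min_eq_left h1, max_eq_right (by linarith)]; ring
    · rw [min_eq_right h1, max_eq_left (by linarith)]; ring
  · simp [hτ]
  · rw [Real.sign_of_pos h, abs_of_pos h, one_mul]
    exact (max_eq_right ((neg_nonpos.2 hτ).trans (le_min h.le hτ))).symm

lemma measurable_trunc {τ : ℝ} (hτ : 0 ≤ τ) : Measurable (trunc τ) := by
  have : trunc τ = fun y => max (-τ) (min y τ) := funext (trunc_eq hτ)
  rw [this]; fun_prop

lemma abs_trunc_le {τ : ℝ} (hτ : 0 ≤ τ) (y : ℝ) : |trunc τ y| ≤ τ := by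
  rw [trunc_eq hτ, abs_le]
  exact ⟨le_max_left _ _, max_le (by linarith) (min_le_right _ _)⟩

lemma abs_trunc_le_abs {τ : ℝ} (hτ : 0 ≤ τ) (y : ℝ) : |trunc τ y| ≤ |y| := by
  rw [trunc_eq hτ, abs_le]
  refine ⟨le_max_of_le_right (le_min (neg_abs_le y) ?_), max_le ?_ ?_⟩
  · linarith [abs_nonneg y]
  · linarith [abs_nonneg y]
  · exact (min_le_left _ _).trans (le_abs_self y)

lemma trunc_eq_self {τ y : ℝ} (h : |y| ≤ τ) : trunc τ y = y := by
  rw [trunc_eq ((abs_nonneg y).trans h), min_eq_left ((le_abs_self y).trans h),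
    max_eq_right ((neg_le_neg h).trans (neg_abs_le y))]

lemma abs_trunc_sub_le_abs {τ : ℝ} (hτ : 0 ≤ τ) (y : ℝ) : |trunc τ y - y| ≤ |y| := by
  rw [trunc_eq hτ]
  rcases le_total 0 y with h | h
  · rw [abs_of_nonneg h, max_eq_right ((neg_nonpos.2 hτ).trans (le_min h hτ)), abs_le]
    constructor
    · linarith [le_min h hτ]
    · linarith [min_le_left y τ]
  · rw [abs_of_nonpos h, min_eq_left (h.trans hτ), abs_le]
    constructor
    · linarith [le_max_right (-τ) y]
    · linarith [max_le (neg_nonpos.2 hτ) h]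

lemma abs_trunc_sub_le_sq_div {τ : ℝ} (hτ : 0 < τ) (y : ℝ) : |trunc τ y - y| ≤ y ^ 2 / τ := by
  rcases le_total |y| τ with h | h
  · rw [trunc_eq_self h, sub_self, abs_zero]; positivity
  · refine (abs_trunc_sub_le_abs hτ.le y).trans ?_
    rw [le_div_iff₀ hτ, ← sq_abs y, sq]
    exact mul_le_mul_of_nonneg_left h (abs_nonneg y)

lemma abs_trunc_sub_le_cube_div {τ : ℝ} (hτ : 0 < τ) (y : ℝ) :
    |trunc τ y - y| ≤ |y| ^ 3 / τ ^ 2 := by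
  rcases le_total |y| τ with h | h
  · rw [trunc_eq_self h, sub_self, abs_zero]; positivity
  · refine (abs_trunc_sub_le_abs hτ.le y).trans ?_
    rw [le_div_iff₀ (by positivity)]
    calc |y| * τ ^ 2 ≤ |y| * |y| ^ 2 := by gcongr
      _ = _ := by ring

end Moments

/-! ### The linear model -/

section Model

lemma integral_mul_eq_zero_of_condExp_eq_zero {Ω : Type*} {m m₀ : MeasurableSpace Ω}
    {μ : Measure Ω} [IsFiniteMeasure μ] (hm : m ≤ m₀) {f g : Ω → ℝ} (hf : StronglyMeasurable[m] f)
    (hfg : Integrable (fun ω => f ω * g ω) μ) (hg : Integrable g μ) (h0 : μ[g | m] =ᵐ[μ] 0) :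
    ∫ ω, f ω * g ω ∂μ = 0 := by
  have h2 : μ[f * g | m] =ᵐ[μ] f * μ[g | m] :=
    condExp_mul_of_stronglyMeasurable_left hf hfg hg
  have h3 : μ[f * g | m] =ᵐ[μ] 0 := by
    refine h2.trans ?_
    filter_upwards [h0] with ω hω
    simp [hω]
  have h4 : ∫ ω, (f * g) ω ∂μ = 0 := by
    rw [← integral_condExp hm, integral_congr_ae h3]
    simp
  exact h4

variable {Ω : Type*} [MeasurableSpace Ω] {μ : Measure Ω} {d N : ℕ}
  {x : Fin N → Ω → Fin d → ℝ} {ε Y : Fin N → Ω → ℝ} {θ : Fin d → ℝ}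

lemma IsLinearModel.measurable_response (h : IsLinearModel μ x ε Y θ) (i : Fin N) :
    Measurable (Y i) := by
  have : Y i = fun ω => x i ω ⬝ᵥ θ + ε i ω := funext (h.response_eq i)
  rw [this]
  have h1 := h.measurable_design i
  have h2 := h.measurable_noise i
  simp only [dotProduct]
  fun_prop

/-- Measurable functions of `(x_i, Y_i)` are independent across `i`. -/
lemma IsLinearModel.indep_comp (h : IsLinearModel μ x ε Y θ) {f : (Fin d → ℝ) → ℝ → ℝ}
    (hf : Measurable fun p : (Fin d → ℝ) × ℝ => f p.1 p.2) :
    iIndepFun (fun i ω => f (x i ω) (Y i ω)) μ := by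
  have h1 : Measurable fun p : (Fin d → ℝ) × ℝ => (p.1, p.1 ⬝ᵥ θ + p.2) := by
    simp only [dotProduct]; fun_prop
  have h2 := h.indep.comp (fun _ p => f p.1 (p.1 ⬝ᵥ θ + p.2)) fun _ => hf.comp h1
  have h3 : (fun i ω => f (x i ω) (Y i ω)) =
      fun i => (fun p : (Fin d → ℝ) × ℝ => f p.1 (p.1 ⬝ᵥ θ + p.2)) ∘ fun ω => (x i ω, ε i ω) := by
    funext i ω; simp [h.response_eq]
  rw [h3]; exact h2

lemma integrable_mul_dotProduct {X : Ω → Fin d → ℝ} {j : Fin d}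
    (h : ∀ k, Integrable (fun ω => X ω j * X ω k) μ) (v : Fin d → ℝ) :
    Integrable (fun ω => X ω j * (X ω ⬝ᵥ v)) μ := by
  simp only [dotProduct, Finset.mul_sum, ← mul_assoc]
  exact integrable_finsetSum _ fun k _ => (h k).mul_const _

variable [IsProbabilityMeasure μ]

/-- The normal equations: the noise is orthogonal to the design. -/
lemma IsLinearModel.integral_response_mul (h : IsLinearModel μ x ε Y θ) (i : Fin N) (j : Fin d)
    (hY : Integrable (fun ω => Y i ω * x i ω j) μ)
    (hx : ∀ k, Integrable (fun ω => x i ω j * x i ω k) μ) :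
    ∫ ω, Y i ω * x i ω j ∂μ = ∫ ω, x i ω j * (x i ω ⬝ᵥ θ) ∂μ := by
  have hxθ := integrable_mul_dotProduct hx θ
  have e : ∀ ω, Y i ω * x i ω j - x i ω j * (x i ω ⬝ᵥ θ) = x i ω j * ε i ω := fun ω => by
    rw [h.response_eq]; ring
  have hint : Integrable (fun ω => x i ω j * ε i ω) μ :=
    (hY.sub hxθ).congr (Filter.Eventually.of_forall e)
  rw [← sub_eq_zero, ← integral_sub hY hxθ]
  simp only [e]
  exact integral_mul_eq_zero_of_condExp_eq_zero (h.measurable_design i).comap_le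
    ((measurable_pi_apply j).comp (comap_measurable (x i))).stronglyMeasurable hint
    (h.integrable_noise i) (h.condMean_noise i)

/-- The signal has a smaller second moment than the response. -/
lemma IsLinearModel.integral_signal_sq_le (h : IsLinearModel μ x ε Y θ) (i : Fin N)
    (hY2 : Integrable (fun ω => Y i ω ^ 2) μ)
    (hY : ∀ j, Integrable (fun ω => Y i ω * x i ω j) μ)
    (hx : ∀ j k, Integrable (fun ω => x i ω j * x i ω k) μ) :
    ∫ ω, (θ ⬝ᵥ x i ω) ^ 2 ∂μ ≤ ∫ ω, Y i ω ^ 2 ∂μ := by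
  have h1 : ∀ j, Integrable (fun ω => x i ω j * (x i ω ⬝ᵥ θ)) μ := fun j =>
    integrable_mul_dotProduct (hx j) θ
  have e1 : ∀ ω, (θ ⬝ᵥ x i ω) ^ 2 = ∑ j, θ j * (x i ω j * (x i ω ⬝ᵥ θ)) := fun ω => by
    rw [sq]; nth_rewrite 2 [dotProduct_comm]
    rw [dotProduct, Finset.sum_mul]
    exact Finset.sum_congr rfl fun j _ => by ring
  have e2 : ∀ ω, Y i ω * (θ ⬝ᵥ x i ω) = ∑ j, θ j * (Y i ω * x i ω j) := fun ω => by
    rw [dotProduct, Finset.mul_sum]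
    exact Finset.sum_congr rfl fun j _ => by ring
  have hi1 : Integrable (fun ω => (θ ⬝ᵥ x i ω) ^ 2) μ := by
    simp only [e1]; exact integrable_finsetSum _ fun j _ => (h1 j).const_mul _
  have hi2 : Integrable (fun ω => Y i ω * (θ ⬝ᵥ x i ω)) μ := by
    simp only [e2]; exact integrable_finsetSum _ fun j _ => (hY j).const_mul _
  have heq : ∫ ω, Y i ω * (θ ⬝ᵥ x i ω) ∂μ = ∫ ω, (θ ⬝ᵥ x i ω) ^ 2 ∂μ := by
    simp only [e1, e2]
    rw [integral_finsetSum _ fun j _ => (h1 j).const_mul _,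
      integral_finsetSum _ fun j _ => (hY j).const_mul _]
    refine Finset.sum_congr rfl fun j _ => ?_
    rw [integral_const_mul, integral_const_mul, h.integral_response_mul i j (hY j) (hx j)]
  have h3 : 0 ≤ ∫ ω, (Y i ω ^ 2 + (θ ⬝ᵥ x i ω) ^ 2 - 2 * (Y i ω * (θ ⬝ᵥ x i ω))) ∂μ :=
    integral_nonneg fun ω => by
      change 0 ≤ Y i ω ^ 2 + (θ ⬝ᵥ x i ω) ^ 2 - 2 * (Y i ω * (θ ⬝ᵥ x i ω))
      nlinarith [sq_nonneg (Y i ω - θ ⬝ᵥ x i ω)]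
  have h4 : Integrable (fun ω => Y i ω ^ 2 + (θ ⬝ᵥ x i ω) ^ 2) μ := hY2.add hi1
  rw [integral_sub h4 (hi2.const_mul 2), integral_add hY2 hi1, integral_const_mul, heq] at h3
  linarith

lemma measureReal_le_of_forall {ι : Type*} [Fintype ι] {s : Set Ω} {t : ι → Set Ω} {c : ℝ}
    (hst : s ⊆ ⋃ j, t j) (h : ∀ j, μ.real (t j) ≤ c) : μ.real s ≤ Fintype.card ι * c :=
  calc μ.real s ≤ μ.real (⋃ j, t j) := measureReal_mono hst
    _ ≤ ∑ j, μ.real (t j) := measureReal_iUnion_fintype_le _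
    _ ≤ ∑ _j : ι, c := Finset.sum_le_sum fun j _ => h j
    _ = _ := by simp

/-- Union bound over the coordinates of the score. -/
lemma measureReal_scoreNorm_le {y : Ω → Fin N → ℝ} {X : Ω → Fin N → Fin d → ℝ}
    {θ : Fin d → ℝ} {u c : ℝ} (hu : 0 < u)
    (h : ∀ j, μ.real {ω | u ≤ |(N : ℝ)⁻¹ * ∑ i, (y ω i * X ω i j - X ω i j * (X ω i ⬝ᵥ θ))|} ≤ c) :
    μ.real {ω | u ≤ scoreNorm (y ω) (X ω) θ} ≤ d * c := by
  have := measureReal_le_of_forall (s := {ω | u ≤ scoreNorm (y ω) (X ω) θ}) (fun ω hω => ?_) h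
  · simpa using this
  · by_contra hcon
    simp only [Set.mem_iUnion, Set.mem_ofPred_eq, not_exists, not_le] at hcon hω
    refine absurd hω (not_le.2 ?_)
    rw [scoreNorm, pi_norm_lt_iff hu]
    intro j
    rw [crossCov_sub_sampleCov_apply, Real.norm_eq_abs]
    exact hcon j

end Model

/-! ### The score for a sub-Gaussian design -/

section SubGaussianScore

/-- `exp (A (|x| + |w| + s |x| |w|))`, the common form of the exponential moments of a pair of
sub-Gaussian variables that occur for the score. -/
noncomputable def expPair (A s x w : ℝ) : ℝ := Real.exp (A * (|x| + |w| + s * |x| * |w|))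

lemma expPair_le {A s α : ℝ} (hα : 0 < α) (h : A * s ≤ α / 2) (x w : ℝ) :
    expPair A s x w ≤
      Real.exp (2 * A ^ 2 / α) / 2 * (Real.exp (α * x ^ 2) + Real.exp (α * w ^ 2)) := by
  have hlin : ∀ z : ℝ, A * |z| ≤ α / 4 * z ^ 2 + A ^ 2 / α := fun z => by
    have h1 : 0 ≤ (α / 2 * |z| - A) ^ 2 / α := by positivity
    have h2 : (α / 2 * |z| - A) ^ 2 / α = α / 4 * |z| ^ 2 + A ^ 2 / α - A * |z| := by
      field_simp; ring
    rw [h2, sq_abs] at h1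
    linarith
  have hprod : A * (s * |x| * |w|) ≤ α / 4 * (x ^ 2 + w ^ 2) := by
    have h1 : |x| * |w| ≤ (x ^ 2 + w ^ 2) / 2 := by
      rw [← sq_abs x, ← sq_abs w]; nlinarith [sq_nonneg (|x| - |w|)]
    calc A * (s * |x| * |w|) = (A * s) * (|x| * |w|) := by ring
      _ ≤ α / 2 * (|x| * |w|) := by gcongr
      _ ≤ α / 2 * ((x ^ 2 + w ^ 2) / 2) := by gcongr
      _ = _ := by ring
  have hexp : A * (|x| + |w| + s * |x| * |w|) ≤
      2 * A ^ 2 / α + (α / 2 * x ^ 2 + α / 2 * w ^ 2) := by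
    have := hlin x
    have := hlin w
    have e : 2 * A ^ 2 / α = A ^ 2 / α + A ^ 2 / α := by ring
    rw [mul_add, mul_add, e]
    linarith
  rw [expPair]
  refine (Real.exp_le_exp.2 hexp).trans ?_
  rw [Real.exp_add, Real.exp_add (_ * x ^ 2)]
  have e : ∀ z : ℝ, Real.exp (α * z ^ 2) = Real.exp (α / 2 * z ^ 2) ^ 2 := fun z => by
    rw [← Real.exp_nat_mul]; congr 1; push_cast; ring
  rw [e, e]
  have h2 := mul_nonneg (Real.exp_pos (2 * A ^ 2 / α)).le
    (sq_nonneg (Real.exp (α / 2 * x ^ 2) - Real.exp (α / 2 * w ^ 2)))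
  linarith

/-- Young's inequality with the conjugate exponents `2k/(k+1)` and `2k/(k-1)`. -/
lemma rpow_mul_le_add {k m g : ℝ} (hk : 1 < k) (hm : 0 ≤ m) (hg : 0 ≤ g) :
    m ^ (k + 1) * g ≤ m ^ (2 * k) + g ^ (2 * k / (k - 1)) := by
  have h1 : 0 < k - 1 := by linarith
  have h2 : 0 < k + 1 := by linarith
  have h3 : 0 < k := by linarith
  have hconj : (2 * k / (k + 1)).HolderConjugate (2 * k / (k - 1)) := by
    rw [Real.holderConjugate_iff]
    refine ⟨by rw [lt_div_iff₀ h2]; linarith, ?_⟩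
    field_simp; ring
  have h := Real.young_inequality_of_nonneg (Real.rpow_nonneg hm (k + 1)) hg hconj
  rw [← Real.rpow_mul hm, show (k + 1) * (2 * k / (k + 1)) = 2 * k by field_simp] at h
  refine h.trans (add_le_add ?_ ?_)
  · exact div_le_self (by positivity) hconj.lt.le
  · exact div_le_self (by positivity) hconj.symm.lt.le

/-- `max(1, |y|)^{2k}` has a moment bound as soon as `|y|^{2k}` has. -/
lemma max_one_rpow_le (y p : ℝ) : max 1 |y| ^ p ≤ 1 + |y| ^ p := by
  rcases le_total 1 |y| with h | h
  · rw [max_eq_right h]; linarith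
  · rw [max_eq_left h, Real.one_rpow]; linarith [Real.rpow_nonneg (abs_nonneg y) p]

lemma sq_le_two_mul_exp_abs (x : ℝ) : x ^ 2 ≤ 2 * Real.exp |x| := by
  have := Real.quadratic_le_exp_of_nonneg (abs_nonneg x)
  rw [← sq_abs]; nlinarith [abs_nonneg x]

/-- The integrand of the Bernstein condition for the score. Where `s |y'| ≤ 1` the exponential of
`s y' x` is at most `e^{|x|}`; elsewhere `s |y| > 1`, and the small factor `s^{k-1}` compensates
the constant `B` in `e^{B|x|}`. -/
lemma score_integrand_le {y y' x w s B k : ℝ} (hk : 1 < k) (hs : 0 < s) (hy : |y'| ≤ |y|)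
    (hB : s * |y'| ≤ B) :
    (y' * x - x * w) ^ 2 * Real.exp (s * |y' * x - x * w|) ≤
      12 * (max 1 |y| ^ (2 * k) + expPair (2 * (2 * k / (k - 1))) s x w) +
      12 * s ^ (k - 1) * (max 1 |y| ^ (2 * k) +
        expPair ((1 + B) * (2 * k / (k - 1))) s x w) := by
  set m := max 1 |y| with hm
  have hm1 : 1 ≤ m := le_max_left _ _
  have hm0 : 0 < m := by linarith
  have hym : |y'| ≤ m := hy.trans (le_max_right _ _)
  have hB0 : 0 ≤ B := le_trans (by positivity) hB
  set p := 2 * k / (k - 1) with hp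
  have hsq : (y' * x - x * w) ^ 2 ≤ 12 * m ^ 2 * Real.exp (|x| + |w|) := by
    have h1 : (y' * x - x * w) ^ 2 ≤ 2 * (x ^ 2 * y' ^ 2) + 2 * (x ^ 2 * w ^ 2) := by
      nlinarith [sq_nonneg (y' * x + x * w)]
    have hx := sq_le_two_mul_exp_abs x
    have hw := sq_le_two_mul_exp_abs w
    have hy2 : y' ^ 2 ≤ m ^ 2 := by rw [← sq_abs]; gcongr
    have hw1 : 1 ≤ Real.exp |w| := Real.one_le_exp (abs_nonneg w)
    have hm2 : 1 ≤ m ^ 2 := one_le_pow₀ hm1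
    have h2 : x ^ 2 * y' ^ 2 ≤ 2 * Real.exp |x| * m ^ 2 := by gcongr
    have h3 : x ^ 2 * w ^ 2 ≤ 2 * Real.exp |x| * (2 * Real.exp |w|) := by gcongr
    have h4 : Real.exp |x| * m ^ 2 * 1 ≤ Real.exp |x| * m ^ 2 * Real.exp |w| := by gcongr
    have h5 : Real.exp |x| * Real.exp |w| * 1 ≤ Real.exp |x| * Real.exp |w| * m ^ 2 := by gcongr
    rw [Real.exp_add]
    linarith
  have hexp : Real.exp (s * |y' * x - x * w|) ≤
      (Real.exp |x| + s ^ (k - 1) * m ^ (k - 1) * Real.exp (B * |x|)) *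
        Real.exp (s * |x| * |w|) := by
    have h1 : s * |y' * x - x * w| ≤ s * |y'| * |x| + s * |x| * |w| := by
      have := abs_sub (y' * x) (x * w)
      rw [abs_mul, abs_mul] at this
      calc s * |y' * x - x * w| ≤ s * (|y'| * |x| + |x| * |w|) := by gcongr
        _ = _ := by ring
    refine (Real.exp_le_exp.2 h1).trans ?_
    rw [Real.exp_add]
    refine mul_le_mul_of_nonneg_right ?_ (Real.exp_pos _).le
    rcases le_or_gt (s * |y'|) 1 with h | h
    · refine le_add_of_le_of_nonneg (Real.exp_le_exp.2 ?_) (by positivity)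
      exact mul_le_of_le_one_left (abs_nonneg x) h
    · refine le_add_of_nonneg_of_le (Real.exp_pos _).le ?_
      have h2 : 1 ≤ s ^ (k - 1) * m ^ (k - 1) := by
        rw [← Real.mul_rpow hs.le hm0.le]
        refine Real.one_le_rpow (h.le.trans ?_) (by linarith)
        gcongr
      calc Real.exp (s * |y'| * |x|) ≤ 1 * Real.exp (B * |x|) := by
            rw [one_mul]; gcongr
        _ ≤ _ := by gcongr
  have hpair : ∀ A : ℝ, expPair A s x w ^ p = expPair (A * p) s x w := fun A => by
    rw [expPair, expPair, ← Real.exp_mul]; congr 1; ring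
  have hpos : 0 ≤ |x| + |w| + s * |x| * |w| := by positivity
  have hsx : 0 ≤ s * |x| * |w| := by positivity
  have g1 : Real.exp (|x| + |w|) * Real.exp |x| * Real.exp (s * |x| * |w|) ≤
      expPair 2 s x w := by
    rw [← Real.exp_add, ← Real.exp_add, expPair]
    refine Real.exp_le_exp.2 ?_
    linarith [abs_nonneg w]
  have g2 : Real.exp (|x| + |w|) * Real.exp (B * |x|) * Real.exp (s * |x| * |w|) ≤
      expPair (1 + B) s x w := by
    rw [← Real.exp_add, ← Real.exp_add, expPair]
    refine Real.exp_le_exp.2 ?_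
    linarith [mul_nonneg hB0 (abs_nonneg w), mul_nonneg hB0 hsx]
  have y1 := rpow_mul_le_add (g := expPair 2 s x w) hk hm0.le (Real.exp_pos _).le
  have y2 := rpow_mul_le_add (g := expPair (1 + B) s x w) hk hm0.le (Real.exp_pos _).le
  rw [hpair] at y1 y2
  have hm2k : m ^ 2 ≤ m ^ (k + 1) := by
    rw [← Real.rpow_two]
    exact Real.rpow_le_rpow_of_exponent_le hm1 (by linarith)
  have hmk : m ^ 2 * m ^ (k - 1) = m ^ (k + 1) := by
    rw [← Real.rpow_two, ← Real.rpow_add hm0]; congr 1; ring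
  have hsk : 0 ≤ s ^ (k - 1) := by positivity
  calc (y' * x - x * w) ^ 2 * Real.exp (s * |y' * x - x * w|)
      ≤ (12 * m ^ 2 * Real.exp (|x| + |w|)) *
        ((Real.exp |x| + s ^ (k - 1) * m ^ (k - 1) * Real.exp (B * |x|)) *
          Real.exp (s * |x| * |w|)) := by gcongr
    _ = 12 * (m ^ 2 * (Real.exp (|x| + |w|) * Real.exp |x| * Real.exp (s * |x| * |w|))) +
        12 * s ^ (k - 1) * (m ^ 2 * m ^ (k - 1) *
          (Real.exp (|x| + |w|) * Real.exp (B * |x|) * Real.exp (s * |x| * |w|))) := by ring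
    _ ≤ 12 * (m ^ (k + 1) * expPair 2 s x w) +
        12 * s ^ (k - 1) * (m ^ (k + 1) * expPair (1 + B) s x w) := by
        rw [hmk]; gcongr
    _ ≤ _ := by gcongr

variable {Ω : Type*} [MeasurableSpace Ω] {μ : Measure Ω}

lemma expPair_integrable {A s α : ℝ} (hα : 0 < α) (h : A * s ≤ α / 2)
    {X W : Ω → ℝ} (hX : Measurable X) (hW : Measurable W)
    (hXi : Integrable (fun ω => Real.exp (α * X ω ^ 2)) μ)
    (hX2 : ∫ ω, Real.exp (α * X ω ^ 2) ∂μ ≤ 2)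
    (hWi : Integrable (fun ω => Real.exp (α * W ω ^ 2)) μ)
    (hW2 : ∫ ω, Real.exp (α * W ω ^ 2) ∂μ ≤ 2) :
    Integrable (fun ω => expPair A s (X ω) (W ω)) μ ∧
      ∫ ω, expPair A s (X ω) (W ω) ∂μ ≤ 2 * Real.exp (2 * A ^ 2 / α) := by
  have h1 := integrable_and_integral_le (μ := μ) (f := fun ω => expPair A s (X ω) (W ω))
    (by unfold expPair; fun_prop)
    ((hXi.add hWi).const_mul (Real.exp (2 * A ^ 2 / α) / 2)) (fun ω => (Real.exp_pos _).le)
    (fun ω => expPair_le hα h (X ω) (W ω))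
  refine ⟨h1.1, h1.2.trans ?_⟩
  rw [integral_const_mul]
  rw [integral_add' hXi hWi]
  have := mul_le_mul_of_nonneg_left (add_le_add hX2 hW2)
    (by positivity : 0 ≤ Real.exp (2 * A ^ 2 / α) / 2)
  linarith

variable [IsProbabilityMeasure μ]

lemma max_one_rpow_integrable {p M : ℝ} {Y : Ω → ℝ} (hY : Measurable Y)
    (hi : Integrable (fun ω => |Y ω| ^ p) μ) (hM : ∫ ω, |Y ω| ^ p ∂μ ≤ M) :
    Integrable (fun ω => max 1 |Y ω| ^ p) μ ∧ ∫ ω, max 1 |Y ω| ^ p ∂μ ≤ 1 + M := by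
  have h1 := integrable_and_integral_le (μ := μ) (f := fun ω => max 1 |Y ω| ^ p)
    ((measurable_const.max (continuous_abs.measurable.comp hY)).pow_const p)
    ((integrable_const 1).add hi) (fun ω => by positivity)
    (fun ω => max_one_rpow_le (Y ω) p)
  refine ⟨h1.1, h1.2.trans ?_⟩
  rw [integral_add' (integrable_const _) hi, integral_const, probReal_univ, one_smul]
  linarith

/-- The Bernstein condition for one coordinate of the score. The bound does not depend on `B`
once `s` is small in terms of `B`. -/
lemma score_bernstein {k M α s B : ℝ} (hk : 1 < k) (hα : 0 < α) (hs : 0 < s)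
    {Y Y' X W : Ω → ℝ} (hY : Measurable Y) (hY' : Measurable Y')
    (hX : Measurable X) (hW : Measurable W)
    (hYi : Integrable (fun ω => |Y ω| ^ (2 * k)) μ) (hYM : ∫ ω, |Y ω| ^ (2 * k) ∂μ ≤ M)
    (hXi : Integrable (fun ω => Real.exp (α * X ω ^ 2)) μ)
    (hX2 : ∫ ω, Real.exp (α * X ω ^ 2) ∂μ ≤ 2)
    (hWi : Integrable (fun ω => Real.exp (α * W ω ^ 2)) μ)
    (hW2 : ∫ ω, Real.exp (α * W ω ^ 2) ∂μ ≤ 2)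
    (hle : ∀ ω, |Y' ω| ≤ |Y ω|) (hB : ∀ ω, s * |Y' ω| ≤ B)
    (hs1 : 2 * (2 * k / (k - 1)) * s ≤ α / 2)
    (hs2 : (1 + B) * (2 * k / (k - 1)) * s ≤ α / 2)
    (hs3 : s ^ (k - 1) *
      (1 + M + 2 * Real.exp (2 * ((1 + B) * (2 * k / (k - 1))) ^ 2 / α)) ≤ 1) :
    Integrable (fun ω => (Y' ω * X ω - X ω * W ω) ^ 2 *
        Real.exp (s * |Y' ω * X ω - X ω * W ω|)) μ ∧
      ∫ ω, (Y' ω * X ω - X ω * W ω) ^ 2 * Real.exp (s * |Y' ω * X ω - X ω * W ω|) ∂μ ≤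
        12 * (1 + M + 2 * Real.exp (2 * (2 * (2 * k / (k - 1))) ^ 2 / α)) + 12 := by
  have hp : 0 < 2 * k / (k - 1) := div_pos (by linarith) (by linarith)
  have hm := max_one_rpow_integrable hY hYi hYM
  have hE1 := expPair_integrable hα hs1 hX hW hXi hX2 hWi hW2
  have hE2 := expPair_integrable hα hs2 hX hW hXi hX2 hWi hW2
  have hi1 := hm.1.add hE1.1
  have hi2 := hm.1.add hE2.1
  have h := integrable_and_integral_le (μ := μ)
    (f := fun ω => (Y' ω * X ω - X ω * W ω) ^ 2 * Real.exp (s * |Y' ω * X ω - X ω * W ω|))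
    (by fun_prop) ((hi1.const_mul 12).add (hi2.const_mul (12 * s ^ (k - 1))))
    (fun ω => by positivity) (fun ω => score_integrand_le hk hs (hle ω) (hB ω))
  refine ⟨h.1, h.2.trans ?_⟩
  rw [integral_add' (hi1.const_mul 12) (hi2.const_mul _), integral_const_mul, integral_const_mul,
    integral_add' hm.1 hE1.1, integral_add' hm.1 hE2.1]
  have h2 := mul_le_mul_of_nonneg_left (add_le_add hm.2 hE2.2)
    (by positivity : 0 ≤ s ^ (k - 1))
  have h3 := h2.trans hs3
  linarith [hm.2, hE1.2]

lemma sq_mul_abs_le {k y x w s : ℝ} (hk : 1 < k) (hs : 0 ≤ s) :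
    y ^ 2 * |x| ≤ max 1 |y| ^ (2 * k) + expPair (2 * (2 * k / (k - 1))) s x w := by
  have hm1 : 1 ≤ max 1 |y| := le_max_left _ _
  have h1 : y ^ 2 ≤ max 1 |y| ^ (k + 1) := by
    calc y ^ 2 ≤ max 1 |y| ^ 2 := by
          rw [← sq_abs]
          gcongr
          exact le_max_right _ _
      _ ≤ _ := by
          rw [← Real.rpow_two]
          exact Real.rpow_le_rpow_of_exponent_le hm1 (by linarith)
  have h2 : |x| ≤ expPair 2 s x w := by
    have := Real.add_one_le_exp (2 * (|x| + |w| + s * |x| * |w|))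
    have h3 : 0 ≤ s * |x| * |w| := by positivity
    rw [expPair]
    linarith [abs_nonneg x, abs_nonneg w]
  have hpair : expPair 2 s x w ^ (2 * k / (k - 1)) = expPair (2 * (2 * k / (k - 1))) s x w := by
    rw [expPair, expPair, ← Real.exp_mul]; congr 1; ring
  rw [← hpair]
  refine le_trans ?_ (rpow_mul_le_add hk (by positivity) (Real.exp_pos _).le)
  gcongr

/-- The bias caused by truncating the response. -/
lemma score_bias {k M α s τ : ℝ} (hk : 1 < k) (hα : 0 < α) (hs : 0 ≤ s) (hτ : 0 < τ)
    {Y X W : Ω → ℝ} (hY : Measurable Y) (hX : Measurable X) (hW : Measurable W)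
    (hYi : Integrable (fun ω => |Y ω| ^ (2 * k)) μ) (hYM : ∫ ω, |Y ω| ^ (2 * k) ∂μ ≤ M)
    (hXi : Integrable (fun ω => Real.exp (α * X ω ^ 2)) μ)
    (hX2 : ∫ ω, Real.exp (α * X ω ^ 2) ∂μ ≤ 2)
    (hWi : Integrable (fun ω => Real.exp (α * W ω ^ 2)) μ)
    (hW2 : ∫ ω, Real.exp (α * W ω ^ 2) ∂μ ≤ 2)
    (hs1 : 2 * (2 * k / (k - 1)) * s ≤ α / 2)
    (hYX : Integrable (fun ω => Y ω * X ω) μ) (hXW : Integrable (fun ω => X ω * W ω) μ)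
    (hnormal : ∫ ω, Y ω * X ω ∂μ = ∫ ω, X ω * W ω ∂μ) :
    Integrable (fun ω => trunc τ (Y ω) * X ω - X ω * W ω) μ ∧
      |∫ ω, (trunc τ (Y ω) * X ω - X ω * W ω) ∂μ| ≤
        (1 + M + 2 * Real.exp (2 * (2 * (2 * k / (k - 1))) ^ 2 / α)) / τ := by
  have hp : 0 < 2 * k / (k - 1) := div_pos (by linarith) (by linarith)
  have hm := max_one_rpow_integrable hY hYi hYM
  have hE1 := expPair_integrable hα hs1 hX hW hXi hX2 hWi hW2
  have hmeas : Measurable fun ω => trunc τ (Y ω) := (measurable_trunc hτ.le).comp hY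
  have hTX : Integrable (fun ω => trunc τ (Y ω) * X ω) μ := by
    refine hYX.mono (hmeas.mul hX).aestronglyMeasurable (Filter.Eventually.of_forall fun ω => ?_)
    rw [norm_mul, norm_mul]
    exact mul_le_mul_of_nonneg_right (abs_trunc_le_abs hτ.le _) (norm_nonneg _)
  refine ⟨hTX.sub hXW, ?_⟩
  rw [integral_sub hTX hXW, ← hnormal, ← integral_sub hTX hYX]
  have hsum := (hm.1.add hE1.1).const_mul τ⁻¹
  rw [← Real.norm_eq_abs]
  refine (norm_integral_le_of_norm_le hsum (Filter.Eventually.of_forall fun ω => ?_)).trans ?_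
  · rw [← sub_mul, norm_mul, Real.norm_eq_abs, Real.norm_eq_abs]
    calc _ ≤ Y ω ^ 2 / τ * |X ω| := by gcongr; exact abs_trunc_sub_le_sq_div hτ _
      _ = τ⁻¹ * (Y ω ^ 2 * |X ω|) := by ring
      _ ≤ _ := by gcongr; exact sq_mul_abs_le hk hs
  · rw [integral_const_mul, integral_add' hm.1 hE1.1, inv_mul_eq_div]
    gcongr
    · exact hm.2
    · exact hE1.2

end SubGaussianScore

/-! ### From tail bounds to the error of the estimator -/

section EstimateTail

variable {Ω : Type*} [MeasurableSpace Ω] {μ : Measure Ω} [IsProbabilityMeasure μ] {d N : ℕ}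

/-- The restricted lower bound `vᵀ Σ̂ v ≥ κ ‖v‖₂² - B ‖v‖₁²` fails for some `v`. -/
def RestrictedBoundFails (X : Fin N → Fin d → ℝ) (κ B : ℝ) : Prop :=
  ∃ v : Fin d → ℝ, v ⬝ᵥ (sampleCov X *ᵥ v) < κ * l2Norm v ^ 2 - B * l1Norm v ^ 2

lemma measureReal_estimate_error_le {y : Ω → Fin N → ℝ} {X : Ω → Fin N → Fin d → ℝ}
    {θ : Fin d → ℝ} {θhat : Ω → Fin d → ℝ} {q ρ t ν κ B P : ℝ} (ht : 0 < t) (hν : 0 < ν)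
    (hκ : 0 < κ) (hB : 0 ≤ B) (hq0 : 0 ≤ q) (hq1 : q ≤ 1) (hρ : 0 < ρ) (hlq : lqSum q θ ≤ ρ)
    (hest : ∀ ω, IsEstimate (y ω) (X ω) (2 * ν * √t) (θhat ω))
    (hscore : μ.real {ω | ν * √t < scoreNorm (y ω) (X ω) θ} ≤ 2 * P)
    (hrsc : μ.real {ω | RestrictedBoundFails (X ω) κ B} ≤ P)
    (hBW : B * (ρ * √t ^ (-q)) ≤ κ / 64) :
    μ.real {ω |
      (2 + 144 * ν ^ 2 / κ ^ 2 + 32 * ν / κ) * ρ * t ^ (1 - q / 2) <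
          l2Norm (θhat ω - θ) ^ 2 ∨
      (4 * √(2 + 144 * ν ^ 2 / κ ^ 2 + 32 * ν / κ) + 4) * ρ * t ^ ((1 - q) / 2) <
          l1Norm (θhat ω - θ)} ≤ 3 * P := by
  have hs : 0 < √t := Real.sqrt_pos.2 ht
  have e0 : √t ^ (-q) = t ^ (-q / 2) := by
    rw [Real.sqrt_eq_rpow, ← Real.rpow_mul ht.le]; congr 1; ring
  have e1 : ρ * √t ^ (-q) * √t ^ 2 = ρ * t ^ (1 - q / 2) := by
    rw [e0, Real.sq_sqrt ht.le, mul_assoc, ← Real.rpow_add_one ht.ne']; congr 2; ring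
  have e2 : ρ * √t ^ (-q) * √t = ρ * t ^ ((1 - q) / 2) := by
    rw [e0, Real.sqrt_eq_rpow, mul_assoc, ← Real.rpow_add ht]; congr 2; ring
  calc _ ≤ μ.real ({ω | ν * √t < scoreNorm (y ω) (X ω) θ} ∪
        {ω | RestrictedBoundFails (X ω) κ B}) := by
        refine measureReal_mono fun ω hω => ?_
        by_contra hcon
        rw [Set.mem_union, not_or] at hcon
        simp only [Set.mem_ofPred_eq, RestrictedBoundFails, not_lt, not_exists] at hcon hω
        have h := estimate_error_le hs hν hκ hB hq0 hq1 hρ hlq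
          (by rw [← mul_assoc]; exact hest ω) hcon.1 hcon.2 hBW
        rw [e1, e2, ← mul_assoc, ← mul_assoc] at h
        exact hω.elim (not_lt.2 h.1) (not_lt.2 h.2)
    _ ≤ _ := (measureReal_union_le _ _).trans (by linarith)

end EstimateTail

/-! ### The restricted lower bound for a sub-Gaussian design -/

section SubGaussianRestricted

variable {Ω : Type*} [MeasurableSpace Ω] {μ : Measure Ω} [IsProbabilityMeasure μ] {d N : ℕ}

/-- Lower tail bounds on the finitely many sums of `n` signed basis vectors, with a bound on the
diagonal, give the restricted lower bound for all vectors at once. -/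
lemma measureReal_restrictedBoundFails_le {X : Fin N → Ω → Fin d → ℝ} (hN : 1 ≤ N)
    (hm : ∀ i, Measurable (X i)) (hind : iIndepFun X μ) {κ K α : ℝ} (hκ : 0 < κ) (hK : 0 < K)
    (hα : 0 < α) (h2 : ∀ i z, Integrable (fun ω => (z ⬝ᵥ X i ω) ^ 2) μ)
    (hlow : ∀ i z, κ * l2Norm z ^ 2 ≤ ∫ ω, (z ⬝ᵥ X i ω) ^ 2 ∂μ)
    (h4 : ∀ i z, Integrable (fun ω => ((z ⬝ᵥ X i ω) ^ 2) ^ 2) μ)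
    (hup : ∀ i z, ∫ ω, ((z ⬝ᵥ X i ω) ^ 2) ^ 2 ∂μ ≤ K * l2Norm z ^ 4)
    (hei : ∀ i j, Integrable (fun ω => Real.exp (α * X i ω j ^ 2)) μ)
    (he : ∀ i j, ∫ ω, Real.exp (α * X i ω j ^ 2) ∂μ ≤ 2) {n : ℕ} (hn : 2 ≤ n) :
    μ.real {ω | RestrictedBoundFails (fun i => X i ω) (κ / 2) (2 / α / (n - 1))} ≤
      (2 * d : ℝ) ^ n * Real.exp (-(N * (κ ^ 2 / (16 * K)))) + d * Real.exp (-N) := by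
  have hN' : (0 : ℝ) < N := by exact_mod_cast hN
  set s1 : signedSums d n → Set Ω := fun z =>
    {ω | z.1 ⬝ᵥ (sampleCov (fun i => X i ω) *ᵥ z.1) < κ / 2 * l2Norm z.1 ^ 2} with hs1
  set s2 : Fin d → Set Ω := fun j =>
    {ω | 2 / α ≤ sampleCov (fun i => X i ω) j j} with hs2
  have hcov : ∀ ω (z : Fin d → ℝ), z ⬝ᵥ (sampleCov (fun i => X i ω) *ᵥ z) =
      (N : ℝ)⁻¹ * ∑ i, (z ⬝ᵥ X i ω) ^ 2 := fun ω z => by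
    rw [dotProduct_sampleCov_mulVec]
    congr 1
    exact Finset.sum_congr rfl fun i _ => by rw [dotProduct_comm (X i ω), sq]
  have hsub : {ω | RestrictedBoundFails (fun i => X i ω) (κ / 2) (2 / α / (n - 1))} ⊆
      (⋃ z, s1 z) ∪ ⋃ j, s2 j := by
    intro ω hω
    by_contra hcon
    rw [Set.mem_union, not_or] at hcon
    simp only [hs1, hs2, Set.mem_iUnion, Set.mem_ofPred_eq, not_exists, not_lt, not_le] at hcon
    obtain ⟨v, hv⟩ := hω
    set S := sampleCov (fun i => X i ω) with hS
    -- the transfer principle is applied to `Σ̂ - (κ/2) I`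
    have hq : ∀ z w : Fin d → ℝ, z ⬝ᵥ ((S - (κ / 2) • (1 : Matrix (Fin d) (Fin d) ℝ)) *ᵥ w) =
        z ⬝ᵥ (S *ᵥ w) - κ / 2 * (z ⬝ᵥ w) := fun z w => by
      rw [sub_mulVec, smul_mulVec, one_mulVec, dotProduct_sub, dotProduct_smul, smul_eq_mul]
    have hself : ∀ z : Fin d → ℝ, z ⬝ᵥ z = l2Norm z ^ 2 := fun z => by
      rw [l2Norm_sq]; exact Finset.sum_congr rfl fun j _ => (sq (z j)).symm
    have h := quadratic_ge_of_signedSums (A := S - (κ / 2) • (1 : Matrix (Fin d) (Fin d) ℝ))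
      (fun z w => by rw [hq, hq, sampleCov_comm, dotProduct_comm z w]) hn
      (fun z hz => by rw [hq, hself]; linarith [hcon.1 ⟨z, hz⟩]) (U := 2 / α)
      (fun j => by
        have := (hcon.2 j).le
        simp only [Matrix.sub_apply, Matrix.smul_apply, Matrix.one_apply_eq, smul_eq_mul]
        linarith) v
    rw [hq, hself] at h
    linarith
  have hp1 : ∀ z, μ.real (s1 z) ≤ Real.exp (-(N * (κ ^ 2 / (16 * K)))) := fun z => by
    rcases (l2Norm_nonneg z.1).eq_or_lt with h0 | hpos
    · have : s1 z = ∅ := by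
        ext ω
        simp [hs1, l2Norm_eq_zero h0.symm, l2Norm]
      rw [this, measureReal_empty]; exact (Real.exp_pos _).le
    have h := measureReal_mean_le_half_le (W := fun i ω => (z.1 ⬝ᵥ X i ω) ^ 2)
      (κ := κ * l2Norm z.1 ^ 2) (K := K * l2Norm z.1 ^ 4) hN
      (fun i => by have := hm i; simp only [dotProduct]; fun_prop)
      (hind.comp (fun _ x => (z.1 ⬝ᵥ x) ^ 2) fun _ => by simp only [dotProduct]; fun_prop)
      (by positivity) (by positivity) (fun i ω => sq_nonneg _) (fun i => h2 i z.1)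
      (fun i => h4 i z.1) (fun i => hlow i z.1) (fun i => hup i z.1)
    have e : (κ * l2Norm z.1 ^ 2) ^ 2 / (16 * (K * l2Norm z.1 ^ 4)) = κ ^ 2 / (16 * K) := by
      field_simp
    rw [e] at h
    refine (measureReal_mono fun ω hω => ?_).trans h
    simp only [hs1, Set.mem_ofPred_eq, hcov] at hω ⊢
    linarith
  have hp2 : ∀ j, μ.real (s2 j) ≤ Real.exp (-N) := fun j => by
    have h := measureReal_mean_ge_le_of_exp (W := fun i ω => α * X i ω j ^ 2) hN
      (fun i => by have := hm i; fun_prop)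
      (hind.comp (fun _ x => α * x j ^ 2) fun _ => by fun_prop)
      (fun i => hei i j) (fun i => he i j)
    refine (measureReal_mono fun ω hω => ?_).trans h
    simp only [hs2, Set.mem_ofPred_eq, sampleCov_apply] at hω ⊢
    rw [div_le_iff₀ hα] at hω
    rw [← Finset.mul_sum]
    simp only [← sq] at hω
    linarith
  calc _ ≤ μ.real ((⋃ z, s1 z) ∪ ⋃ j, s2 j) := measureReal_mono hsub
    _ ≤ μ.real (⋃ z, s1 z) + μ.real (⋃ j, s2 j) := measureReal_union_le _ _
    _ ≤ Fintype.card (signedSums d n) * Real.exp (-(N * (κ ^ 2 / (16 * K)))) +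
        Fintype.card (Fin d) * Real.exp (-N) :=
      add_le_add (measureReal_le_of_forall subset_rfl hp1)
        (measureReal_le_of_forall subset_rfl hp2)
    _ ≤ _ := by
      rw [Fintype.card_coe, Fintype.card_fin]
      gcongr
      exact card_signedSums_le n

/-- The choice `n ≈ c N / (4 log d)` in the union bound over sums of `n` signed basis vectors. -/
lemma exists_sparsity_level {c δ L : ℝ} {d N : ℕ} (hc : 0 < c) (hd : 2 ≤ d)
    (hL : L = Real.log d) (hN : ((16 + 2 * δ) / c + 1 + δ) * L ≤ N) (hδ : 0 ≤ δ) :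
    ∃ n : ℕ, 2 ≤ n ∧ 1 / ((n : ℝ) - 1) ≤ 8 / c * (L / N) ∧
      (2 * d : ℝ) ^ n * Real.exp (-(N * c)) + d * Real.exp (-N) ≤ (d : ℝ) ^ (1 - δ) := by
  have hd2 : (2 : ℝ) ≤ d := by exact_mod_cast hd
  have hd0 : (0 : ℝ) < d := by linarith
  have hL0 : 0 < L := hL ▸ Real.log_pos (by linarith)
  have hexpL : Real.exp L = d := by rw [hL, Real.exp_log hd0]
  have hNpos : (0 : ℝ) < N := lt_of_lt_of_le (by positivity) hN
  have hcN : 16 * L + 2 * δ * L ≤ c * N := by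
    have h1 : (16 + 2 * δ) / c * L ≤ N := by nlinarith
    have h2 := mul_le_mul_of_nonneg_left h1 hc.le
    have h3 : c * ((16 + 2 * δ) / c * L) = 16 * L + 2 * δ * L := by field_simp
    linarith
  have hN2 : (1 + δ) * L ≤ N := by
    have : 0 ≤ (16 + 2 * δ) / c * L := by positivity
    linarith
  set X : ℝ := c * N / (4 * L) with hX
  have hX4 : 4 ≤ X := by
    rw [hX, le_div_iff₀ (by positivity)]
    nlinarith [mul_nonneg hδ hL0.le]
  have hfl := Nat.floor_le (by linarith : 0 ≤ X)
  have hfl2 := Nat.lt_floor_add_one X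
  refine ⟨⌊X⌋₊, Nat.le_floor (by norm_num; linarith), ?_, ?_⟩
  · have h1 : X / 2 ≤ (⌊X⌋₊ : ℝ) - 1 := by linarith
    calc 1 / ((⌊X⌋₊ : ℝ) - 1) ≤ 1 / (X / 2) := by gcongr
      _ = _ := by rw [hX]; field_simp; norm_num
  · have h1 : (2 * d : ℝ) ^ ⌊X⌋₊ * Real.exp (-(N * c)) ≤ Real.exp (-(δ * L)) := by
      calc (2 * d : ℝ) ^ ⌊X⌋₊ * Real.exp (-(N * c))
          ≤ Real.exp (2 * L) ^ ⌊X⌋₊ * Real.exp (-(N * c)) := by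
            gcongr
            rw [two_mul L, Real.exp_add, hexpL]
            gcongr
        _ = Real.exp (⌊X⌋₊ * (2 * L) - N * c) := by
            rw [← Real.exp_nat_mul, ← Real.exp_add, sub_eq_add_neg]
        _ ≤ _ := by
            refine Real.exp_le_exp.2 ?_
            have h2 : X * (2 * L) = c * N / 2 := by rw [hX]; field_simp; norm_num
            have h3 : (⌊X⌋₊ : ℝ) * (2 * L) ≤ X * (2 * L) := by gcongr
            nlinarith
    have h2 : d * Real.exp (-N) ≤ Real.exp (-(δ * L)) := by
      rw [← hexpL, ← Real.exp_add]
      refine Real.exp_le_exp.2 ?_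
      linarith
    have h3 : (d : ℝ) ^ (1 - δ) = d * Real.exp (-(δ * L)) := by
      nth_rewrite 2 [← hexpL]
      rw [Real.rpow_def_of_pos hd0, ← Real.exp_add, ← hL]
      congr 1; ring
    rw [h3]
    nlinarith [Real.exp_pos (-(δ * L))]

end SubGaussianRestricted

/-! ### The sub-Gaussian design -/

section SubGaussianModel

/-- Upper bound for `‖θ*‖₂` (from `κ_L ‖θ*‖₂² ≤ E Y² ≤ 1 + M`), at least `1`. -/
noncomputable def signalRadius (κL M : ℝ) : ℝ := 1 + √((1 + M) / κL)

/-- A constant `α` with `E exp (α x_{ij}²) ≤ 2` and `E exp (α (x_iᵀ θ*)²) ≤ 2`. -/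
noncomputable def expRate (κ₀ κL M : ℝ) : ℝ :=
  (4 * Real.exp 1 * κ₀ ^ 2 * signalRadius κL M ^ 2)⁻¹

/-- The moment bound `1 + M + 2 e^{2A²/α}` for `max(1, |Y|)^{2k} + expPair A`. -/
noncomputable def pairMoment (M α A : ℝ) : ℝ := 1 + M + 2 * Real.exp (2 * A ^ 2 / α)

variable {Ω : Type*} [MeasurableSpace Ω] {μ : Measure Ω} {d N : ℕ}
  {x : Fin N → Ω → Fin d → ℝ} {ε Y : Fin N → Ω → ℝ} {θ : Fin d → ℝ} {κ₀ κL M k : ℝ}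

lemma one_le_signalRadius : 1 ≤ signalRadius κL M := by
  unfold signalRadius; linarith [Real.sqrt_nonneg ((1 + M) / κL)]

lemma expRate_pos (hκ₀ : 0 < κ₀) : 0 < expRate κ₀ κL M := by
  have := one_le_signalRadius (κL := κL) (M := M)
  unfold expRate; positivity

lemma l2Norm_single_one (j : Fin d) : l2Norm (Pi.single j (1 : ℝ)) = 1 := by
  rw [l2Norm, Finset.sum_eq_single j]
  · simp
  · intro b _ hb; simp [hb]
  · simp

lemma integrable_sq_of_integrable_exp {α : ℝ} (hα : 0 < α) {X : Ω → ℝ} (hX : Measurable X)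
    (h : Integrable (fun ω => Real.exp (α * X ω ^ 2)) μ) : Integrable (fun ω => X ω ^ 2) μ :=
  (integrable_and_integral_le (by fun_prop) (h.const_mul α⁻¹) (fun ω => sq_nonneg _) fun ω => by
    have := Real.add_one_le_exp (α * X ω ^ 2)
    rw [inv_mul_eq_div, le_div_iff₀ hα]; linarith).1

lemma fourth_moment_of_exp {α : ℝ} (hα : 0 < α) {X : Ω → ℝ} (hX : Measurable X)
    (h : Integrable (fun ω => Real.exp (α * X ω ^ 2)) μ)
    (h2 : ∫ ω, Real.exp (α * X ω ^ 2) ∂μ ≤ 2) :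
    Integrable (fun ω => (X ω ^ 2) ^ 2) μ ∧ ∫ ω, (X ω ^ 2) ^ 2 ∂μ ≤ 4 / α ^ 2 := by
  have h1 := integrable_and_integral_le (μ := μ) (f := fun ω => (X ω ^ 2) ^ 2) (by fun_prop)
    (h.const_mul (2 / α ^ 2)) (fun ω => by positivity) fun ω => by
      have h0 : 0 ≤ α * X ω ^ 2 := by positivity
      have := Real.quadratic_le_exp_of_nonneg h0
      rw [div_mul_eq_mul_div, le_div_iff₀ (by positivity)]
      nlinarith
  refine ⟨h1.1, h1.2.trans ?_⟩
  rw [integral_const_mul]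
  calc 2 / α ^ 2 * ∫ ω, Real.exp (α * X ω ^ 2) ∂μ ≤ 2 / α ^ 2 * 2 := by gcongr
    _ = _ := by ring

lemma measurable_dotProduct_comp {X : Ω → Fin d → ℝ} (hX : Measurable X) (v : Fin d → ℝ) :
    Measurable fun ω => v ⬝ᵥ X ω := by
  simp only [dotProduct]; fun_prop

variable [IsProbabilityMeasure μ]

lemma SubGaussianDesign.exp_moment (hD : SubGaussianDesign μ x κ₀ κL) (hκ₀ : 0 < κ₀)
    (hm : ∀ i, Measurable (x i)) (i : Fin N) {v : Fin d → ℝ}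
    (hv : l2Norm v ≤ signalRadius κL M) :
    Integrable (fun ω => Real.exp (expRate κ₀ κL M * (v ⬝ᵥ x i ω) ^ 2)) μ ∧
      ∫ ω, Real.exp (expRate κ₀ κL M * (v ⬝ᵥ x i ω) ^ 2) ∂μ ≤ 2 :=
  exp_dotProduct_sq_of_psi2NormVec_le (hm i) hκ₀
    (lt_of_lt_of_le one_pos one_le_signalRadius) (hD.psi2_le i) hv

lemma SubGaussianDesign.exp_moment_coord (hD : SubGaussianDesign μ x κ₀ κL) (hκ₀ : 0 < κ₀)
    (hm : ∀ i, Measurable (x i)) (i : Fin N) (j : Fin d) :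
    Integrable (fun ω => Real.exp (expRate κ₀ κL M * x i ω j ^ 2)) μ ∧
      ∫ ω, Real.exp (expRate κ₀ κL M * x i ω j ^ 2) ∂μ ≤ 2 := by
  have h := hD.exp_moment (M := M) hκ₀ hm i (v := Pi.single j 1)
    (by rw [l2Norm_single_one]; exact one_le_signalRadius)
  simpa only [single_dotProduct, one_mul] using h

lemma SubGaussianDesign.memLp_coord (hD : SubGaussianDesign μ x κ₀ κL) (hκ₀ : 0 < κ₀)
    (hm : ∀ i, Measurable (x i)) (i : Fin N) (j : Fin d) :
    MemLp (fun ω => x i ω j) 2 μ := by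
  have hmj : Measurable fun ω => x i ω j := by have := hm i; fun_prop
  rw [memLp_two_iff_integrable_sq hmj.aestronglyMeasurable]
  exact integrable_sq_of_integrable_exp (expRate_pos (κL := κL) (M := 0) hκ₀) hmj
    (hD.exp_moment_coord hκ₀ hm i j).1

lemma memLp_two_of_rpow_integrable (hk : 1 < k) {Z : Ω → ℝ} (hZ : Measurable Z)
    (hi : Integrable (fun ω => |Z ω| ^ (2 * k)) μ) (hM : ∫ ω, |Z ω| ^ (2 * k) ∂μ ≤ M) :
    MemLp Z 2 μ ∧ ∫ ω, Z ω ^ 2 ∂μ ≤ 1 + M := by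
  have hm := max_one_rpow_integrable hZ hi hM
  have h := integrable_and_integral_le (μ := μ) (f := fun ω => Z ω ^ 2) (by fun_prop) hm.1
    (fun ω => sq_nonneg _) fun ω => by
      calc Z ω ^ 2 ≤ max 1 |Z ω| ^ (2 : ℝ) := by
            rw [Real.rpow_two, ← sq_abs]
            gcongr
            exact le_max_right _ _
        _ ≤ _ := Real.rpow_le_rpow_of_exponent_le (le_max_left _ _) (by linarith)
  rw [memLp_two_iff_integrable_sq hZ.aestronglyMeasurable]
  exact ⟨h.1, h.2.trans hm.2⟩

lemma SubGaussianDesign.l2Norm_le (hD : SubGaussianDesign μ x κ₀ κL) (hκ₀ : 0 < κ₀)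
    (hκL : 0 < κL) (h : IsLinearModel μ x ε Y θ) (i : Fin N) (hY2 : MemLp (Y i) 2 μ)
    (hYM : ∫ ω, Y i ω ^ 2 ∂μ ≤ 1 + M) : l2Norm θ ≤ signalRadius κL M := by
  have hxL := hD.memLp_coord hκ₀ h.measurable_design i
  have h1 := h.integral_signal_sq_le i hY2.integrable_sq (fun j => hY2.integrable_mul (hxL j))
    (fun j k => (hxL j).integrable_mul (hxL k))
  rw [integral_dotProduct_sq fun j k => (hxL j).integrable_mul (hxL k)] at h1
  have h2 := (hD.minEigenvalue i).le_quadratic (secondMoment_isHermitian _) θ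
  have h3 : l2Norm θ ^ 2 ≤ (1 + M) / κL := by
    rw [le_div_iff₀ hκL]; linarith
  have h4 := Real.le_sqrt_of_sq_le h3
  unfold signalRadius
  linarith

/-- Tail bound for the score with a sub-Gaussian design. -/
lemma SubGaussianDesign.measureReal_score_le (hD : SubGaussianDesign μ x κ₀ κL) (hκ₀ : 0 < κ₀)
    (hκL : 0 < κL) (hM : 0 ≤ M) (hk : 1 < k) (hN : 1 ≤ N) (h : IsLinearModel μ x ε Y θ)
    (hY : ∀ i, absMoment μ (2 * k) (Y i) ≤ ENNReal.ofReal M) {s τ B u : ℝ} (hs : 0 < s)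
    (hτ : 0 < τ) (hu : 0 < u) (hB : s * τ ≤ B)
    (hs1 : 2 * (2 * k / (k - 1)) * s ≤ expRate κ₀ κL M / 2)
    (hs2 : (1 + B) * (2 * k / (k - 1)) * s ≤ expRate κ₀ κL M / 2)
    (hs3 : s ^ (k - 1) *
      pairMoment M (expRate κ₀ κL M) ((1 + B) * (2 * k / (k - 1))) ≤ 1) :
    μ.real {ω | u ≤ scoreNorm (truncResponse τ Y ω) (design x ω) θ} ≤
      d * (2 * Real.exp (-(N * (s * u -
        s * (pairMoment M (expRate κ₀ κL M) (2 * (2 * k / (k - 1))) / τ) -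
        s ^ 2 * (12 * pairMoment M (expRate κ₀ κL M) (2 * (2 * k / (k - 1))) + 12))))) := by
  have hα : 0 < expRate κ₀ κL M := expRate_pos hκ₀
  have hYm := h.measurable_response
  have hmom : ∀ i, Integrable (fun ω => |Y i ω| ^ (2 * k)) μ ∧
      ∫ ω, |Y i ω| ^ (2 * k) ∂μ ≤ M := fun i => absMoment_integrable hM (hYm i) (hY i)
  have hY2 := fun i => memLp_two_of_rpow_integrable hk (hYm i) (hmom i).1 (hmom i).2
  have hxL := hD.memLp_coord hκ₀ h.measurable_design
  have hθ : l2Norm θ ≤ signalRadius κL M :=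
    hD.l2Norm_le hκ₀ hκL h ⟨0, hN⟩ (hY2 _).1 (hY2 _).2
  have hcomm : ∀ i ω, x i ω ⬝ᵥ θ = θ ⬝ᵥ x i ω := fun i ω => dotProduct_comm _ _
  have hxm : ∀ i j, Measurable fun ω => x i ω j := fun i j => by
    have := h.measurable_design i; fun_prop
  have hwm : ∀ i, Measurable fun ω => x i ω ⬝ᵥ θ := fun i => by
    simp only [hcomm]; exact measurable_dotProduct_comp (h.measurable_design i) θ
  have hX := hD.exp_moment_coord (M := M) hκ₀ h.measurable_design
  have hW : ∀ i, Integrable (fun ω => Real.exp (expRate κ₀ κL M * (x i ω ⬝ᵥ θ) ^ 2)) μ ∧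
      ∫ ω, Real.exp (expRate κ₀ κL M * (x i ω ⬝ᵥ θ) ^ 2) ∂μ ≤ 2 := fun i => by
    simp only [hcomm]; exact hD.exp_moment hκ₀ h.measurable_design i hθ
  refine measureReal_scoreNorm_le hu fun j => ?_
  have hbern := fun i => score_bernstein (Y' := fun ω => trunc τ (Y i ω)) hk hα hs (hYm i) ((measurable_trunc hτ.le).comp (hYm i))
    (hxm i j) (hwm i) (hmom i).1 (hmom i).2 (hX i j).1 (hX i j).2 (hW i).1 (hW i).2
    (fun ω => abs_trunc_le_abs hτ.le _)
    (fun ω => (mul_le_mul_of_nonneg_left (abs_trunc_le hτ.le _) hs.le).trans hB) hs1 hs2 hs3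
  have hxx := fun i k => (hxL i j).integrable_mul (hxL i k)
  have hbias := fun i => score_bias (τ := τ) hk hα hs.le hτ (hYm i) (hxm i j) (hwm i) (hmom i).1
    (hmom i).2 (hX i j).1 (hX i j).2 (hW i).1 (hW i).2 hs1 ((hY2 i).1.integrable_mul (hxL i j))
    (integrable_mul_dotProduct (hxx i) θ)
    (h.integral_response_mul i j ((hY2 i).1.integrable_mul (hxL i j)) (hxx i))
  have hf : Measurable fun p : (Fin d → ℝ) × ℝ => trunc τ p.2 * p.1 j - p.1 j * (p.1 ⬝ᵥ θ) := by
    have := (measurable_trunc hτ.le).comp (measurable_snd : Measurable (Prod.snd : (Fin d → ℝ) × ℝ → ℝ))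
    simp only [dotProduct]
    refine Measurable.sub (Measurable.mul this (by fun_prop)) (by fun_prop)
  have htail := measureReal_abs_mean_ge_le (m := fun _ => 0)
    (Z := fun i ω => trunc τ (Y i ω) * x i ω j - x i ω j * (x i ω ⬝ᵥ θ)) hN
    (fun i => ((((measurable_trunc hτ.le).comp (hYm i)).mul (hxm i j)).sub
      ((hxm i j).mul (hwm i))))
    (h.indep_comp (f := fun v t => trunc τ t * v j - v j * (v ⬝ᵥ θ)) hf) hs
    (fun i => (hbias i).1) (fun i => (hbern i).1) (fun i => (hbern i).2)
    (fun i => by simpa only [sub_zero] using (hbias i).2) u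
  simp only [sub_zero] at htail
  exact htail

/-- The restricted lower bound for a sub-Gaussian design, with an error of order `log d / N`. -/
lemma SubGaussianDesign.measureReal_restrictedBoundFails_le (hD : SubGaussianDesign μ x κ₀ κL)
    (hκ₀ : 0 < κ₀) (hκL : 0 < κL) (hN : 1 ≤ N) (hd : 2 ≤ d)
    (h : IsLinearModel μ x ε Y θ) {α c δ : ℝ} (hαdef : α = expRate κ₀ κL 0)
    (hc : c = κL ^ 2 / (16 * (4 * (4 * Real.exp 1 * κ₀ ^ 2) ^ 2))) (hδ : 0 ≤ δ)
    (hNL : ((16 + 2 * δ) / c + 1 + δ) * Real.log d ≤ N) :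
    μ.real {ω | RestrictedBoundFails (design x ω) (κL / 2)
      (16 / (α * c) * (Real.log d / N))} ≤ (d : ℝ) ^ (1 - δ) := by
  have hc0 : 0 < c := by rw [hc]; positivity
  have hα0 : 0 < α := hαdef ▸ expRate_pos hκ₀
  obtain ⟨n, hn2, hn, hprob⟩ := exists_sparsity_level hc0 hd rfl hNL hδ
  have hxL := hD.memLp_coord hκ₀ h.measurable_design
  have hxx := fun i j k => (hxL i j).integrable_mul (hxL i k)
  have hmeas := fun i (z : Fin d → ℝ) => measurable_dotProduct_comp (h.measurable_design i) z
  have hzero : ∀ z : Fin d → ℝ, 0 = l2Norm z → z = 0 := fun z hz => l2Norm_eq_zero hz.symm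
  have h2 : ∀ i z, Integrable (fun ω => (z ⬝ᵥ x i ω) ^ 2) μ := fun i z => by
    rcases (l2Norm_nonneg z).eq_or_lt with h0 | hpos
    · simp [hzero z h0]
    · exact integrable_sq_of_integrable_exp (by positivity) (hmeas i z)
        (exp_dotProduct_sq_of_psi2NormVec_le (h.measurable_design i) hκ₀ hpos (hD.psi2_le i)
          le_rfl).1
  have h4 : ∀ i z, Integrable (fun ω => ((z ⬝ᵥ x i ω) ^ 2) ^ 2) μ ∧
      ∫ ω, ((z ⬝ᵥ x i ω) ^ 2) ^ 2 ∂μ ≤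
        4 * (4 * Real.exp 1 * κ₀ ^ 2) ^ 2 * l2Norm z ^ 4 := fun i z => by
    rcases (l2Norm_nonneg z).eq_or_lt with h0 | hpos
    · simp [hzero z h0, l2Norm]
    · have he := exp_dotProduct_sq_of_psi2NormVec_le (h.measurable_design i) hκ₀ hpos
        (hD.psi2_le i) (v := z) le_rfl
      have h5 := fourth_moment_of_exp (by positivity) (hmeas i z) he.1 he.2
      refine ⟨h5.1, h5.2.trans (le_of_eq ?_)⟩
      rw [inv_pow, div_inv_eq_mul]; ring
  have hcoord := hD.exp_moment_coord (M := 0) hκ₀ h.measurable_design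
  rw [← hαdef] at hcoord
  have hmain := RobustRegression.measureReal_restrictedBoundFails_le hN h.measurable_design
    (h.indep.comp (fun _ => Prod.fst) fun _ => measurable_fst) hκL
    (by positivity) hα0 h2
    (fun i z => by
      rw [integral_dotProduct_sq (hxx i)]
      exact (hD.minEigenvalue i).le_quadratic (secondMoment_isHermitian _) z)
    (fun i z => (h4 i z).1) (fun i z => (h4 i z).2) (fun i j => (hcoord i j).1)
    (fun i j => (hcoord i j).2) hn2
  rw [← hc] at hmain
  refine (measureReal_mono fun ω hω => ?_).trans (hmain.trans hprob)
  obtain ⟨v, hv⟩ := hω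
  refine ⟨v, hv.trans_le ?_⟩
  have h6 : 2 / α / (n - 1) ≤ 16 / (α * c) * (Real.log d / N) := by
    calc 2 / α / ((n : ℝ) - 1) = 2 / α * (1 / ((n : ℝ) - 1)) := by ring
      _ ≤ 2 / α * (8 / c * (Real.log d / N)) := by gcongr
      _ = _ := by field_simp; ring
  gcongr

end SubGaussianModel

/-! ### Constants for the sub-Gaussian design -/

lemma measureReal_le_mul_rpow_of_le_one {Ω : Type*} [MeasurableSpace Ω] {μ : Measure Ω}
    [IsProbabilityMeasure μ] {d : ℕ} (hd : 2 ≤ d) {δ c : ℝ} (hδ : δ ≤ 1) (hc : 1 ≤ c)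
    (S : Set Ω) : μ.real S ≤ c * (d : ℝ) ^ (1 - δ) := by
  have hd1 : (1 : ℝ) ≤ d := by exact_mod_cast (by omega : 1 ≤ d)
  have h1 : (1 : ℝ) ≤ (d : ℝ) ^ (1 - δ) := Real.one_le_rpow hd1 (by linarith)
  exact measureReal_le_one.trans (one_le_mul_of_one_le_of_one_le hc h1)

lemma rpow_one_sub_eq {d : ℕ} (hd : 2 ≤ d) (δ : ℝ) :
    (d : ℝ) ^ (1 - δ) = d * Real.exp (-(δ * Real.log d)) := by
  have hd0 : (0 : ℝ) < d := by exact_mod_cast (by omega : 0 < d)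
  rw [Real.rpow_sub hd0, Real.rpow_one, Real.rpow_def_of_pos hd0, Real.exp_neg, mul_comm δ]
  rfl

lemma pairMoment_pos {M α A : ℝ} (hM : 0 ≤ M) : 0 < pairMoment M α A := by
  unfold pairMoment; positivity

/-- A threshold below which the smallness conditions on `s` for the score hold. -/
lemma exists_small_score_scale {α p B k Q : ℝ} (hα : 0 < α) (hp : 0 < p) (hB : 0 ≤ B)
    (hk : 1 < k) (hQ : 0 < Q) :
    ∃ s₁ : ℝ, 0 < s₁ ∧ ∀ s, 0 < s → s ≤ s₁ →
      2 * p * s ≤ α / 2 ∧ (1 + B) * p * s ≤ α / 2 ∧ s ^ (k - 1) * Q ≤ 1 := by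
  have hk1 : 0 < k - 1 := by linarith
  refine ⟨min (α / (4 * p)) (min (α / (2 * ((1 + B) * p))) (Q⁻¹ ^ (k - 1)⁻¹)), by positivity,
    fun s hs hle => ⟨?_, ?_, ?_⟩⟩
  · have h := hle.trans (min_le_left _ _)
    rw [le_div_iff₀ (by positivity)] at h
    linarith
  · have h := hle.trans ((min_le_right _ _).trans (min_le_left _ _))
    rw [le_div_iff₀ (by positivity)] at h
    linarith
  · have h := hle.trans ((min_le_right _ _).trans (min_le_right _ _))
    have h2 : s ^ (k - 1) ≤ Q⁻¹ := by
      calc s ^ (k - 1) ≤ (Q⁻¹ ^ (k - 1)⁻¹) ^ (k - 1) := by gcongr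
        _ = Q⁻¹ := Real.rpow_inv_rpow (by positivity) hk1.ne'
    calc s ^ (k - 1) * Q ≤ Q⁻¹ * Q := by gcongr
      _ = 1 := inv_mul_cancel₀ hQ.ne'

/-- The constants for the sub-Gaussian design. The score constant `ν` is free of `δ`; only the
thresholds on `log d / N` depend on `δ`. -/
theorem exists_constants_subGaussian {κ₀ κL M k a b : ℝ} (hκ₀ : 0 < κ₀) (hκL : 0 < κL)
    (hM : 0 < M) (hk : 1 < k) (ha : 0 < a) (hab : a ≤ b) :
    ∃ ν₁ C₂ C₃ : ℝ, 0 < ν₁ ∧ 0 < C₂ ∧ 0 < C₃ ∧ ∀ δ : ℝ, 0 < δ →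
      ∃ γ₁ C₁ : ℝ, 0 < γ₁ ∧ 0 < C₁ ∧
      ∀ (Ω : Type*) [MeasurableSpace Ω] (μ : Measure Ω) [IsProbabilityMeasure μ]
        (d N : ℕ) (x : Fin N → Ω → Fin d → ℝ) (ε Y : Fin N → Ω → ℝ) (θs : Fin d → ℝ) (τ : ℝ),
        2 ≤ d → 1 ≤ N →
        IsLinearModel μ x ε Y θs →
        SubGaussianDesign μ x κ₀ κL →
        (∀ i, absMoment μ (2 * k) (Y i) ≤ ENNReal.ofReal M) →
        a * √(N / Real.log d) ≤ τ → τ ≤ b * √(N / Real.log d) →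
        (Real.log d / N < γ₁ →
          μ.real {ω | ν₁ * √(δ * Real.log d / N) ≤
            scoreNorm (truncResponse τ Y ω)
              (design x ω) θs} ≤ 2 * (d : ℝ) ^ (1 - δ)) ∧
        (∀ q ρ : ℝ, 0 ≤ q → q ≤ 1 → 1 < ρ → lqSum q θs ≤ ρ →
          ρ * (Real.log d / N) ^ (1 - q / 2) ≤ C₁ →
          ∀ θhat : Ω → Fin d → ℝ,
          (∀ ω, IsEstimate (truncResponse τ Y ω)
            (design x ω) (2 * ν₁ * √(δ * Real.log d / N)) (θhat ω)) →
          μ.real {ω |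
              C₂ * ρ * (δ * Real.log d / N) ^ (1 - q / 2) <
                l2Norm (θhat ω - θs) ^ 2 ∨
              C₃ * ρ * (δ * Real.log d / N) ^ ((1 - q) / 2) <
                l1Norm (θhat ω - θs)} ≤ 3 * (d : ℝ) ^ (1 - δ)) := by
  have hb : 0 < b := ha.trans_le hab
  set p : ℝ := 2 * k / (k - 1) with hp
  have hp0 : 0 < p := div_pos (by linarith) (by linarith)
  set α := expRate κ₀ κL M with hα
  have hα0 : 0 < α := expRate_pos hκ₀
  set α' := expRate κ₀ κL 0 with hα'
  have hα'0 : 0 < α' := expRate_pos hκ₀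
  set Q := pairMoment M α (2 * p) with hQ
  have hQ0 : 0 < Q := pairMoment_pos hM.le
  set V := 12 * Q + 12 with hV
  -- `Q / a` pays for the truncation bias and `V` for the variance, in units of `s = √(δ log d / N)`
  set ν := Q / a + V + 1 with hν
  have hν0 : 0 < ν := by positivity
  set c := κL ^ 2 / (16 * (4 * (4 * Real.exp 1 * κ₀ ^ 2) ^ 2)) with hc
  have hc0 : 0 < c := by positivity
  set E := 16 / (α' * c) with hE
  have hE0 : 0 < E := by positivity
  set κ := κL / 2 with hκ
  have hκ0 : 0 < κ := by positivity
  refine ⟨ν, 2 + 144 * ν ^ 2 / κ ^ 2 + 32 * ν / κ,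
    4 * √(2 + 144 * ν ^ 2 / κ ^ 2 + 32 * ν / κ) + 4, hν0, by positivity, by positivity,
    fun δ hδ => ?_⟩
  obtain ⟨s₁, hs₁, hsmall⟩ := exists_small_score_scale (k := k) hα0 hp0
    (by positivity : 0 ≤ b * √δ) hk
    (pairMoment_pos (α := α) (A := (1 + b * √δ) * p) hM.le)
  set D := (16 + 2 * δ) / c + 1 + δ with hD
  have hD0 : 0 < D := by positivity
  refine ⟨s₁ ^ 2 / δ, min (min (1 / 2) (s₁ ^ 2 / δ / 2)) (min (1 / D) (κ / (64 * E))),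
    by positivity, by positivity, ?_⟩
  intro Ω _ μ _ d N x ε Y θ τ hd hN hmod hdes hY hτa hτb
  rcases le_or_gt δ 1 with hδ1 | hδ1
  · exact ⟨fun _ => measureReal_le_mul_rpow_of_le_one hd hδ1 (by norm_num) _,
      fun _ _ _ _ _ _ _ _ _ => measureReal_le_mul_rpow_of_le_one hd hδ1 (by norm_num) _⟩
  have hN0 : (0 : ℝ) < N := by exact_mod_cast hN
  have hL0 : 0 < Real.log d := Real.log_pos (by exact_mod_cast (by omega : 1 < d))
  set L := Real.log d with hL
  have hscore : L / N < s₁ ^ 2 / δ →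
      μ.real {ω | ν * √(δ * L / N) ≤ scoreNorm (truncResponse τ Y ω) (design x ω) θ} ≤
        2 * (d : ℝ) ^ (1 - δ) := by
    intro hlt
    set s := √(δ * L / N) with hs
    have hs0 : 0 < s := Real.sqrt_pos.2 (by positivity)
    have hs2 : s ^ 2 = δ * L / N := Real.sq_sqrt (by positivity)
    have hle : s ≤ s₁ := by
      rw [lt_div_iff₀ hδ] at hlt
      refine Real.sqrt_le_iff.2 ⟨hs₁.le, ?_⟩
      calc δ * L / N = L / N * δ := by ring
        _ ≤ _ := hlt.le
    obtain ⟨h1, h2, h3⟩ := hsmall s hs0 hle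
    have hprod : s * √(N / L) = √δ := by
      rw [hs, ← Real.sqrt_mul (by positivity)]; congr 1; field_simp
    have hτ0 : 0 < τ := lt_of_lt_of_le (by positivity) hτa
    have hsτ : s * τ ≤ b * √δ := by
      calc s * τ ≤ s * (b * √(N / L)) := by gcongr
        _ = b * √δ := by rw [← hprod]; ring
    have hasτ : a ≤ s * τ := by
      calc a ≤ a * √δ := le_mul_of_one_le_right ha.le (Real.one_le_sqrt.2 hδ1.le)
        _ = s * (a * √(N / L)) := by rw [← hprod]; ring
        _ ≤ s * τ := by gcongr
    have hbias : Q / τ ≤ Q / a * s := by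
      rw [div_mul_eq_mul_div, div_le_div_iff₀ hτ0 ha, mul_assoc]
      gcongr
    refine (hdes.measureReal_score_le hκ₀ hκL hM.le hk hN hmod hY hs0 hτ0
      (by positivity : 0 < ν * s) hsτ h1 h2 h3).trans ?_
    rw [rpow_one_sub_eq hd, mul_left_comm]
    gcongr 2 * (d * Real.exp (-?_))
    calc δ * L = N * s ^ 2 := by rw [hs2]; field_simp
      _ = N * (s * (ν * s) - s * (Q / a * s) - s ^ 2 * V) := by rw [hν]; ring
      _ ≤ _ := by gcongr
  refine ⟨hscore, ?_⟩
  intro q ρ hq0 hq1 hρ hlq hC θhat hest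
  set y := L / N with hy
  have hy0 : 0 < y := by positivity
  have hC' : y ^ (1 - q / 2) ≤ min (min (1 / 2) (s₁ ^ 2 / δ / 2)) (min (1 / D) (κ / (64 * E))) :=
    (le_mul_of_one_le_left (by positivity) hρ.le).trans hC
  have hy1 : y < 1 := by
    by_contra hcon
    have h1 := Real.one_le_rpow (not_lt.1 hcon) (by linarith : 0 ≤ 1 - q / 2)
    have h2 := hC'.trans ((min_le_left _ _).trans (min_le_left _ _))
    linarith
  have hyle : y ≤ y ^ (1 - q / 2) := by
    calc y = y ^ (1 : ℝ) := (Real.rpow_one y).symm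
      _ ≤ _ := Real.rpow_le_rpow_of_exponent_ge hy0 hy1.le (by linarith)
  have hyC := hyle.trans hC'
  have hyδ : y < s₁ ^ 2 / δ := by
    have h1 := hyC.trans ((min_le_left _ _).trans (min_le_right _ _))
    have h2 : 0 < s₁ ^ 2 / δ := by positivity
    linarith
  have hyD : D * L ≤ N := by
    have h1 := hyC.trans ((min_le_right _ _).trans (min_le_left _ _))
    rw [hy, div_le_div_iff₀ hN0 hD0] at h1
    linarith
  have ht : 0 < δ * L / N := by positivity
  have hy_t : y ≤ δ * L / N := by
    rw [mul_div_assoc]; exact le_mul_of_one_le_left hy0.le hδ1.le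
  refine measureReal_estimate_error_le (B := E * y) ht hν0 hκ0 (by positivity) hq0 hq1 (by linarith)
    hlq hest ((measureReal_mono fun ω hω => ?_).trans (hscore hyδ))
    (hdes.measureReal_restrictedBoundFails_le hκ₀ hκL hN hd hmod hα' hc hδ.le hyD) ?_
  · simp only [Set.mem_ofPred_eq] at hω ⊢
    exact hω.le
  · have h1 : √(δ * L / N) ^ (-q) ≤ y ^ (-q / 2) := by
      rw [Real.sqrt_eq_rpow, ← Real.rpow_mul ht.le, show 1 / 2 * -q = -q / 2 by ring]
      exact Real.rpow_le_rpow_of_nonpos hy0 hy_t (by linarith)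
    calc E * y * (ρ * √(δ * L / N) ^ (-q)) ≤ E * y * (ρ * y ^ (-q / 2)) := by gcongr
      _ = E * (ρ * y ^ (1 - q / 2)) := by
          rw [show 1 - q / 2 = 1 + -q / 2 by ring, Real.rpow_add hy0, Real.rpow_one]; ring
      _ ≤ E * (κ / (64 * E)) := by
          gcongr
          exact hC.trans ((min_le_right _ _).trans (min_le_right _ _))
      _ = κ / 64 := by field_simp

/-! ### Products of truncated variables with bounded fourth moments -/

section Products

variable {Ω : Type*} [MeasurableSpace Ω] {μ : Measure Ω}

lemma abs_trunc_mul_trunc_sub_le {τ₁ τ₂ T : ℝ} (hT : 0 < T) (h1 : T ≤ τ₁) (h2 : T ≤ τ₂)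
    (y z : ℝ) :
    |trunc τ₁ y * trunc τ₂ z - y * z| ≤ (y ^ 4 + z ^ 4) / T ^ 2 := by
  have hτ1 := hT.trans_le h1
  have hτ2 := hT.trans_le h2
  have e : trunc τ₁ y * trunc τ₂ z - y * z =
      (trunc τ₁ y - y) * trunc τ₂ z + y * (trunc τ₂ z - z) := by ring
  have hmono : |y| ^ 3 * |z| + |y| * |z| ^ 3 ≤ y ^ 4 + z ^ 4 := by
    have e1 : y ^ 4 = |y| ^ 4 := (Even.pow_abs (by decide) y).symm
    have e2 : z ^ 4 = |z| ^ 4 := (Even.pow_abs (by decide) z).symm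
    have e3 : |y| ^ 4 + |z| ^ 4 - (|y| ^ 3 * |z| + |y| * |z| ^ 3) =
        (|y| - |z|) ^ 2 * (|y| ^ 2 + |y| * |z| + |z| ^ 2) := by ring
    have : 0 ≤ (|y| - |z|) ^ 2 * (|y| ^ 2 + |y| * |z| + |z| ^ 2) := by positivity
    rw [e1, e2]; linarith
  calc _ ≤ |trunc τ₁ y - y| * |trunc τ₂ z| + |y| * |trunc τ₂ z - z| := by
        rw [e, ← abs_mul, ← abs_mul]; exact abs_add_le _ _
    _ ≤ |y| ^ 3 / T ^ 2 * |z| + |y| * (|z| ^ 3 / T ^ 2) := by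
        have b1 : |trunc τ₁ y - y| ≤ |y| ^ 3 / T ^ 2 :=
          (abs_trunc_sub_le_cube_div hτ1 y).trans (by gcongr)
        have b2 : |trunc τ₂ z - z| ≤ |z| ^ 3 / T ^ 2 :=
          (abs_trunc_sub_le_cube_div hτ2 z).trans (by gcongr)
        exact add_le_add (mul_le_mul b1 (abs_trunc_le_abs hτ2.le z) (abs_nonneg _) (by positivity))
          (mul_le_mul_of_nonneg_left b2 (abs_nonneg y))
    _ = (|y| ^ 3 * |z| + |y| * |z| ^ 3) / T ^ 2 := by ring
    _ ≤ _ := by gcongr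

/-- Bias, boundedness and second moment of a product of two truncated variables. -/
lemma trunc_mul_trunc_moments [IsProbabilityMeasure μ] {Y Z : Ω → ℝ} (hY : Measurable Y)
    (hZ : Measurable Z) {M τ₁ τ₂ T : ℝ} (hYi : Integrable (fun ω => Y ω ^ 4) μ)
    (hYM : ∫ ω, Y ω ^ 4 ∂μ ≤ M) (hZi : Integrable (fun ω => Z ω ^ 4) μ)
    (hZM : ∫ ω, Z ω ^ 4 ∂μ ≤ M) (hYZ : Integrable (fun ω => Y ω * Z ω) μ) (hT : 0 < T)
    (h1 : T ≤ τ₁) (h2 : T ≤ τ₂) :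
    Integrable (fun ω => trunc τ₁ (Y ω) * trunc τ₂ (Z ω)) μ ∧
    Integrable (fun ω => (trunc τ₁ (Y ω) * trunc τ₂ (Z ω)) ^ 2) μ ∧
    ∫ ω, (trunc τ₁ (Y ω) * trunc τ₂ (Z ω)) ^ 2 ∂μ ≤ M ∧
    |∫ ω, trunc τ₁ (Y ω) * trunc τ₂ (Z ω) ∂μ - ∫ ω, Y ω * Z ω ∂μ| ≤ 2 * M / T ^ 2 := by
  have hτ1 := hT.trans_le h1
  have hτ2 := hT.trans_le h2
  have hm : Measurable fun ω => trunc τ₁ (Y ω) * trunc τ₂ (Z ω) :=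
    ((measurable_trunc hτ1.le).comp hY).mul ((measurable_trunc hτ2.le).comp hZ)
  have hle : ∀ ω, |trunc τ₁ (Y ω) * trunc τ₂ (Z ω)| ≤ |Y ω| * |Z ω| := fun ω => by
    rw [abs_mul]
    exact mul_le_mul (abs_trunc_le_abs hτ1.le _) (abs_trunc_le_abs hτ2.le _) (abs_nonneg _)
      (abs_nonneg _)
  have hi : Integrable (fun ω => trunc τ₁ (Y ω) * trunc τ₂ (Z ω)) μ :=
    hYZ.mono hm.aestronglyMeasurable (Filter.Eventually.of_forall fun ω => by
      rw [Real.norm_eq_abs, Real.norm_eq_abs, abs_mul (Y ω)]; exact hle ω)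
  have hsq := integrable_and_integral_le (μ := μ)
    (f := fun ω => (trunc τ₁ (Y ω) * trunc τ₂ (Z ω)) ^ 2) (hm.pow_const 2)
    ((hYi.add hZi).const_mul (1 / 2)) (fun ω => sq_nonneg _) fun ω => by
      have h3 : (trunc τ₁ (Y ω) * trunc τ₂ (Z ω)) ^ 2 ≤ Y ω ^ 2 * Z ω ^ 2 := by
        rw [← sq_abs (_ * _), ← sq_abs (Y ω), ← sq_abs (Z ω), ← mul_pow]
        exact pow_le_pow_left₀ (abs_nonneg _) (hle ω) 2
      simp only [Pi.add_apply]
      nlinarith [sq_nonneg (Y ω ^ 2 - Z ω ^ 2)]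
  refine ⟨hi, hsq.1, hsq.2.trans ?_, ?_⟩
  · rw [integral_const_mul, integral_add' hYi hZi]; linarith
  · rw [← integral_sub hi hYZ, ← Real.norm_eq_abs]
    refine (norm_integral_le_of_norm_le ((hYi.add hZi).const_mul (T ^ 2)⁻¹)
      (Filter.Eventually.of_forall fun ω => ?_)).trans ?_
    · rw [Real.norm_eq_abs, inv_mul_eq_div]
      exact abs_trunc_mul_trunc_sub_le hT h1 h2 _ _
    · rw [integral_const_mul, integral_add' hYi hZi, inv_mul_eq_div]
      gcongr; linarith

/-- A weighted combination of variables with second moment at most `M`: Cauchy-Schwarz. -/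
lemma integral_sub_sum_sq_le {d : ℕ} {M R : ℝ} {θ : Fin d → ℝ} (hθ : l1Norm θ ≤ R)
    {P₀ : Ω → ℝ} {P : Fin d → Ω → ℝ} (hM : 0 ≤ M) (hm0 : Measurable P₀)
    (hm : ∀ k, Measurable (P k)) (h0 : Integrable (fun ω => P₀ ω ^ 2) μ)
    (h0M : ∫ ω, P₀ ω ^ 2 ∂μ ≤ M) (h : ∀ k, Integrable (fun ω => P k ω ^ 2) μ)
    (hPM : ∀ k, ∫ ω, P k ω ^ 2 ∂μ ≤ M) :
    Integrable (fun ω => (P₀ ω - ∑ k, P k ω * θ k) ^ 2) μ ∧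
      ∫ ω, (P₀ ω - ∑ k, P k ω * θ k) ^ 2 ∂μ ≤ 2 * M * (1 + R ^ 2) := by
  have hR : 0 ≤ R := (l1Norm_nonneg θ).trans hθ
  have hsum : Integrable (fun ω => ∑ k, |θ k| * P k ω ^ 2) μ :=
    integrable_finsetSum _ fun k _ => (h k).const_mul _
  have hg := (h0.const_mul 2).add (hsum.const_mul (2 * R))
  have hpt : ∀ ω, (P₀ ω - ∑ k, P k ω * θ k) ^ 2 ≤
      2 * P₀ ω ^ 2 + 2 * R * ∑ k, |θ k| * P k ω ^ 2 := fun ω => by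
    have hcs : (∑ k, P k ω * θ k) ^ 2 ≤ (∑ k, |θ k|) * ∑ k, |θ k| * P k ω ^ 2 :=
      Finset.sum_sq_le_sum_mul_sum_of_sq_le_mul _ (fun k _ => abs_nonneg _)
        (fun k _ => by positivity) fun k _ => by
          rw [mul_pow, ← sq_abs (θ k)]; exact le_of_eq (by ring)
    have h1 : (∑ k, |θ k|) * ∑ k, |θ k| * P k ω ^ 2 ≤ R * ∑ k, |θ k| * P k ω ^ 2 :=
      mul_le_mul_of_nonneg_right hθ (Finset.sum_nonneg fun k _ => by positivity)
    nlinarith [sq_nonneg (P₀ ω + ∑ k, P k ω * θ k)]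
  have h2 := integrable_and_integral_le (μ := μ) (f := fun ω => (P₀ ω - ∑ k, P k ω * θ k) ^ 2)
    (by fun_prop) hg (fun ω => sq_nonneg _) hpt
  refine ⟨h2.1, h2.2.trans ?_⟩
  rw [integral_add' (h0.const_mul 2) (hsum.const_mul _), integral_const_mul, integral_const_mul,
    integral_finsetSum _ fun k _ => (h k).const_mul _]
  have h3 : ∑ k, ∫ ω, |θ k| * P k ω ^ 2 ∂μ ≤ R * M := by
    calc _ ≤ ∑ k, |θ k| * M := Finset.sum_le_sum fun k _ => by
          rw [integral_const_mul]
          exact mul_le_mul_of_nonneg_left (hPM k) (abs_nonneg _)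
      _ = l1Norm θ * M := by rw [← Finset.sum_mul]; rfl
      _ ≤ _ := by gcongr
  have h4 : 2 * R * ∑ k, ∫ ω, |θ k| * P k ω ^ 2 ∂μ ≤ 2 * R * (R * M) := by gcongr
  linarith

/-- The Bernstein condition for a variable with `s |Z| ≤ c` and bounded second moment. -/
lemma bernstein_of_bounded {Z : Ω → ℝ} (hZ : Measurable Z) {s c V : ℝ}
    (hb : ∀ ω, s * |Z ω| ≤ c) (hi : Integrable (fun ω => Z ω ^ 2) μ)
    (hV : ∫ ω, Z ω ^ 2 ∂μ ≤ V) :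
    Integrable (fun ω => Z ω ^ 2 * Real.exp (s * |Z ω|)) μ ∧
      ∫ ω, Z ω ^ 2 * Real.exp (s * |Z ω|) ∂μ ≤ Real.exp c * V := by
  have h := integrable_and_integral_le (μ := μ)
    (f := fun ω => Z ω ^ 2 * Real.exp (s * |Z ω|)) (by fun_prop) (hi.const_mul (Real.exp c))
    (fun ω => by positivity) fun ω => by
      rw [mul_comm (Real.exp c)]
      exact mul_le_mul_of_nonneg_left (Real.exp_le_exp.2 (hb ω)) (sq_nonneg _)
  refine ⟨h.1, h.2.trans ?_⟩
  rw [integral_const_mul]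
  gcongr

end Products

/-! ### The design with bounded fourth moments -/

section BoundedMoments

variable {Ω : Type*} [MeasurableSpace Ω] {μ : Measure Ω} {d N : ℕ}
  {x : Fin N → Ω → Fin d → ℝ} {ε Y : Fin N → Ω → ℝ} {θ : Fin d → ℝ} {κL M R : ℝ}

lemma fourth_moment_of_absMoment (hM : 0 ≤ M) {Z : Ω → ℝ} (hZ : Measurable Z)
    (h : absMoment μ 4 Z ≤ ENNReal.ofReal M) :
    Integrable (fun ω => Z ω ^ 4) μ ∧ ∫ ω, Z ω ^ 4 ∂μ ≤ M := by
  have h1 := absMoment_integrable hM hZ h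
  have e : ∀ ω, |Z ω| ^ (4 : ℝ) = Z ω ^ 4 := fun ω => by
    rw [show (4 : ℝ) = ((4 : ℕ) : ℝ) by norm_num, Real.rpow_natCast]
    exact Even.pow_abs (by decide) _
  simpa only [e] using h1

lemma BoundedMomentDesign.fourth_moment (hD : BoundedMomentDesign μ x M κL) (hM : 0 ≤ M)
    (hm : ∀ i, Measurable (x i)) (i : Fin N) (j : Fin d) :
    Integrable (fun ω => x i ω j ^ 4) μ ∧ ∫ ω, x i ω j ^ 4 ∂μ ≤ M := by
  have h1 := absMoment_integrable hM (by have := hm i; fun_prop) (hD.moment_le i j j)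
  have e : ∀ ω, |x i ω j * x i ω j| ^ (2 : ℝ) = x i ω j ^ 4 := fun ω => by
    rw [Real.rpow_two, sq_abs]; ring
  simpa only [e] using h1

variable [IsProbabilityMeasure μ]

lemma memLp_two_of_fourth {Z : Ω → ℝ} (hZ : Measurable Z)
    (h : Integrable (fun ω => Z ω ^ 4) μ) : MemLp Z 2 μ := by
  rw [memLp_two_iff_integrable_sq hZ.aestronglyMeasurable]
  exact (integrable_and_integral_le (by fun_prop) ((integrable_const (1 : ℝ)).add h)
    (fun ω => sq_nonneg _) fun ω => by
      simp only [Pi.add_apply]; nlinarith [sq_nonneg (Z ω ^ 2 - 1)]).1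

/-- Tail bound for the score with truncated design. Here `s τ₁ τ₂` is bounded, so that the
Bernstein condition holds for bounded variables. -/
lemma BoundedMomentDesign.measureReal_score_le (hD : BoundedMomentDesign μ x M κL) (hM : 0 ≤ M)
    (hN : 1 ≤ N) (h : IsLinearModel μ x ε Y θ) (hθ : l1Norm θ ≤ R)
    (hY : ∀ i, absMoment μ 4 (Y i) ≤ ENNReal.ofReal M) {s τ₁ τ₂ T c u : ℝ} (hs : 0 < s)
    (hT : 0 < T) (h1 : T ≤ τ₁) (h2 : T ≤ τ₂) (hu : 0 < u) (hc1 : s * (τ₁ * τ₂) ≤ c)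
    (hc2 : s * (τ₂ * τ₂) ≤ c) :
    μ.real {ω | u ≤ scoreNorm (truncResponse τ₁ Y ω) (truncDesign τ₂ x ω) θ} ≤
      d * (2 * Real.exp (-(N * (s * u - s * ((1 + R) * (2 * M / T ^ 2)) -
        s ^ 2 * (Real.exp (c * (1 + R)) * (2 * M * (1 + R ^ 2))))))) := by
  have hτ1 := hT.trans_le h1
  have hτ2 := hT.trans_le h2
  have hc0 : 0 ≤ c := le_trans (by positivity) hc1
  have hR : 0 ≤ R := (l1Norm_nonneg θ).trans hθ
  have hYm := h.measurable_response
  have hxm : ∀ i j, Measurable fun ω => x i ω j := fun i j => by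
    have := h.measurable_design i; fun_prop
  have hY4 := fun i => fourth_moment_of_absMoment hM (hYm i) (hY i)
  have hx4 := hD.fourth_moment hM h.measurable_design
  have hYL := fun i => memLp_two_of_fourth (hYm i) (hY4 i).1
  have hxL := fun i j => memLp_two_of_fourth (hxm i j) (hx4 i j).1
  have hYx := fun i j => (hYL i).integrable_mul (hxL i j)
  have hxx : ∀ i j k, Integrable (fun ω => x i ω j * x i ω k) μ := fun i j k =>
    (hxL i j).integrable_mul (hxL i k)
  refine measureReal_scoreNorm_le hu fun j => ?_
  set P₀ : Fin N → Ω → ℝ := fun i ω => trunc τ₁ (Y i ω) * trunc τ₂ (x i ω j) with hP₀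
  set P : Fin N → Fin d → Ω → ℝ := fun i k ω => trunc τ₂ (x i ω j) * trunc τ₂ (x i ω k) with hP
  have hP₀mom := fun i => trunc_mul_trunc_moments (hYm i) (hxm i j) (hY4 i).1 (hY4 i).2
    (hx4 i j).1 (hx4 i j).2 (hYx i j) hT h1 h2
  have hPmom := fun i k => trunc_mul_trunc_moments (hxm i j) (hxm i k) (hx4 i j).1 (hx4 i j).2
    (hx4 i k).1 (hx4 i k).2 (hxx i j k) hT h2 h2
  have ht1 := measurable_trunc hτ1.le
  have ht2 := measurable_trunc hτ2.le
  have hP₀m : ∀ i, Measurable (P₀ i) := fun i => (ht1.comp (hYm i)).mul (ht2.comp (hxm i j))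
  have hPm : ∀ i k, Measurable (P i k) := fun i k =>
    (ht2.comp (hxm i j)).mul (ht2.comp (hxm i k))
  have hZeq : ∀ i ω, truncResponse τ₁ Y ω i * truncDesign τ₂ x ω i j -
      truncDesign τ₂ x ω i j * (truncDesign τ₂ x ω i ⬝ᵥ θ) =
      P₀ i ω - ∑ k, P i k ω * θ k := fun i ω => by
    simp only [truncResponse, truncDesign, dotProduct, Finset.mul_sum, hP₀, hP, mul_assoc]
  simp only [hZeq]
  have hZm : ∀ i, Measurable fun ω => P₀ i ω - ∑ k, P i k ω * θ k := fun i => by fun_prop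
  have hsq := fun i => integral_sub_sum_sq_le hθ hM (hP₀m i) (hPm i) (hP₀mom i).2.1
    (hP₀mom i).2.2.1 (fun k => (hPmom i k).2.1) (fun k => (hPmom i k).2.2.1)
  have hbdd : ∀ i ω, s * |P₀ i ω - ∑ k, P i k ω * θ k| ≤ c * (1 + R) := fun i ω => by
    have b0 : s * |P₀ i ω| ≤ c := by
      refine le_trans ?_ hc1
      rw [hP₀, abs_mul]
      gcongr
      · exact abs_trunc_le hτ1.le _
      · exact abs_trunc_le hτ2.le _
    have bk : ∀ k, s * |P i k ω| ≤ c := fun k => by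
      refine le_trans ?_ hc2
      rw [hP, abs_mul]
      gcongr
      · exact abs_trunc_le hτ2.le _
      · exact abs_trunc_le hτ2.le _
    have bs : s * |∑ k, P i k ω * θ k| ≤ c * R := by
      calc s * |∑ k, P i k ω * θ k| ≤ s * ∑ k, |P i k ω| * |θ k| := by
            gcongr
            refine (Finset.abs_sum_le_sum_abs _ _).trans (le_of_eq ?_)
            simp only [abs_mul]
        _ = ∑ k, (s * |P i k ω|) * |θ k| := by
            rw [Finset.mul_sum]; exact Finset.sum_congr rfl fun k _ => by ring
        _ ≤ ∑ k, c * |θ k| := by gcongr with k; exact bk k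
        _ = c * l1Norm θ := by rw [← Finset.mul_sum]; rfl
        _ ≤ c * R := by gcongr
    have := mul_le_mul_of_nonneg_left (abs_sub (P₀ i ω) (∑ k, P i k ω * θ k)) hs.le
    linarith
  have hbern := fun i => bernstein_of_bounded (hZm i) (hbdd i) (hsq i).1 (hsq i).2
  have hsumI : ∀ i, Integrable (fun ω => ∑ k, P i k ω * θ k) μ := fun i =>
    integrable_finsetSum _ fun k _ => (hPmom i k).1.mul_const _
  have hZI : ∀ i, Integrable (fun ω => P₀ i ω - ∑ k, P i k ω * θ k) μ := fun i =>
    (hP₀mom i).1.sub (hsumI i)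
  have hbias : ∀ i, |∫ ω, (P₀ i ω - ∑ k, P i k ω * θ k) ∂μ - 0| ≤
      (1 + R) * (2 * M / T ^ 2) := fun i => by
    have hnormal := h.integral_response_mul i j (hYx i j) (hxx i j)
    have e1 : ∫ ω, x i ω j * (x i ω ⬝ᵥ θ) ∂μ = ∑ k, (∫ ω, x i ω j * x i ω k ∂μ) * θ k := by
      simp only [dotProduct, Finset.mul_sum, ← mul_assoc]
      rw [integral_finsetSum _ fun k _ => (hxx i j k).mul_const _]
      exact Finset.sum_congr rfl fun k _ => integral_mul_const _ _
    have e2 : ∫ ω, (P₀ i ω - ∑ k, P i k ω * θ k) ∂μ - 0 =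
        (∫ ω, P₀ i ω ∂μ - ∫ ω, Y i ω * x i ω j ∂μ) -
          ∑ k, (∫ ω, P i k ω ∂μ - ∫ ω, x i ω j * x i ω k ∂μ) * θ k := by
      rw [integral_sub (hP₀mom i).1 (hsumI i),
        integral_finsetSum _ fun k _ => (hPmom i k).1.mul_const _, hnormal, e1]
      simp only [integral_mul_const, sub_mul, Finset.sum_sub_distrib]
      ring
    rw [e2]
    refine (abs_sub _ _).trans ?_
    have b1 := (hP₀mom i).2.2.2
    have b2 : |∑ k, (∫ ω, P i k ω ∂μ - ∫ ω, x i ω j * x i ω k ∂μ) * θ k| ≤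
        2 * M / T ^ 2 * R := by
      calc _ ≤ ∑ k, |(∫ ω, P i k ω ∂μ - ∫ ω, x i ω j * x i ω k ∂μ) * θ k| :=
            Finset.abs_sum_le_sum_abs _ _
        _ ≤ ∑ k, 2 * M / T ^ 2 * |θ k| := Finset.sum_le_sum fun k _ => by
            rw [abs_mul]
            exact mul_le_mul_of_nonneg_right (hPmom i k).2.2.2 (abs_nonneg _)
        _ = 2 * M / T ^ 2 * l1Norm θ := by rw [← Finset.mul_sum]; rfl
        _ ≤ _ := by gcongr
    linarith
  have hf : Measurable fun p : (Fin d → ℝ) × ℝ => trunc τ₁ p.2 * trunc τ₂ (p.1 j) -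
      ∑ k, trunc τ₂ (p.1 j) * trunc τ₂ (p.1 k) * θ k := by
    have m1 : Measurable fun p : (Fin d → ℝ) × ℝ => trunc τ₁ p.2 := ht1.comp measurable_snd
    have m2 : ∀ k, Measurable fun p : (Fin d → ℝ) × ℝ => trunc τ₂ (p.1 k) := fun k =>
      ht2.comp ((measurable_pi_apply k).comp measurable_fst)
    have m3 := m2 j
    fun_prop
  have htail := measureReal_abs_mean_ge_le (m := fun _ => 0)
    (Z := fun i ω => P₀ i ω - ∑ k, P i k ω * θ k) hN hZm
    (h.indep_comp (f := fun v t => trunc τ₁ t * trunc τ₂ (v j) -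
      ∑ k, trunc τ₂ (v j) * trunc τ₂ (v k) * θ k) hf) hs hZI (fun i => (hbern i).1)
    (fun i => (hbern i).2) hbias u
  simp only [sub_zero] at htail
  exact htail

/-- If every entry of the sample covariance is within `u` of its target, the restricted lower
bound holds with error `u ‖v‖₁²`. -/
lemma not_restrictedBoundFails_of_entries {X : Fin N → Fin d → ℝ} {κ u : ℝ} (hN : 1 ≤ N)
    {A : Fin N → Matrix (Fin d) (Fin d) ℝ}
    (hA : ∀ i v, κ * l2Norm v ^ 2 ≤ v ⬝ᵥ (A i *ᵥ v)) (hu : 0 ≤ u)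
    (h : ∀ j k, |(N : ℝ)⁻¹ * ∑ i, (X i j * X i k - A i j k)| ≤ u) :
    ¬ RestrictedBoundFails X κ u := by
  rintro ⟨v, hv⟩
  have hN' : (0 : ℝ) < N := by exact_mod_cast hN
  set S : Matrix (Fin d) (Fin d) ℝ := (N : ℝ)⁻¹ • ∑ i, A i with hS
  have hSv : κ * l2Norm v ^ 2 ≤ v ⬝ᵥ (S *ᵥ v) := by
    rw [hS, smul_mulVec, dotProduct_smul, Matrix.sum_mulVec, dotProduct_sum, smul_eq_mul,
      inv_mul_eq_div, le_div_iff₀ hN']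
    calc κ * l2Norm v ^ 2 * N = ∑ _i : Fin N, κ * l2Norm v ^ 2 := by simp [mul_comm]
      _ ≤ _ := Finset.sum_le_sum fun i _ => hA i v
  have hent : ∀ j k, |(sampleCov X - S) j k| ≤ u := fun j k => by
    have e : (sampleCov X - S) j k = (N : ℝ)⁻¹ * ∑ i, (X i j * X i k - A i j k) := by
      rw [Matrix.sub_apply, sampleCov_apply, hS, Finset.sum_sub_distrib, mul_sub]
      simp [Matrix.sum_apply]
    rw [e]; exact h j k
  have hnorm : ‖(sampleCov X - S) *ᵥ v‖ ≤ u * l1Norm v := by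
    rw [pi_norm_le_iff_of_nonneg (mul_nonneg hu (l1Norm_nonneg v))]
    intro j
    rw [Real.norm_eq_abs]
    refine (abs_dotProduct_le_norm_mul_l1Norm _ v).trans ?_
    refine mul_le_mul_of_nonneg_right ?_ (l1Norm_nonneg v)
    rw [pi_norm_le_iff_of_nonneg hu]
    exact fun k => hent j k
  have hdev : -(u * l1Norm v ^ 2) ≤ v ⬝ᵥ ((sampleCov X - S) *ᵥ v) := by
    rw [dotProduct_comm]
    refine (neg_le_neg ?_).trans (neg_abs_le _)
    refine (abs_dotProduct_le_norm_mul_l1Norm _ v).trans ?_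
    calc _ ≤ u * l1Norm v * l1Norm v := mul_le_mul_of_nonneg_right hnorm (l1Norm_nonneg v)
      _ = _ := by ring
  rw [sub_mulVec, dotProduct_sub] at hdev
  linarith

/-- Tail bound for the restricted lower bound with truncated design. -/
lemma BoundedMomentDesign.measureReal_restrictedBoundFails_le
    (hD : BoundedMomentDesign μ x M κL) (hM : 0 ≤ M) (hN : 1 ≤ N)
    (h : IsLinearModel μ x ε Y θ) {s τ T c u : ℝ} (hs : 0 < s) (hT : 0 < T) (hτ : T ≤ τ)
    (hu : 0 ≤ u) (hc : s * (τ * τ) ≤ c) :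
    μ.real {ω | RestrictedBoundFails (truncDesign τ x ω) κL u} ≤
      (d * d) * (2 * Real.exp (-(N * (s * u - s * (2 * M / T ^ 2) -
        s ^ 2 * (Real.exp c * M))))) := by
  have hτ0 := hT.trans_le hτ
  have hxm : ∀ i j, Measurable fun ω => x i ω j := fun i j => by
    have := h.measurable_design i; fun_prop
  have hx4 := hD.fourth_moment hM h.measurable_design
  have hxL := fun i j => memLp_two_of_fourth (hxm i j) (hx4 i j).1
  have hxx : ∀ i j k, Integrable (fun ω => x i ω j * x i ω k) μ := fun i j k =>
    (hxL i j).integrable_mul (hxL i k)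
  have htr := measurable_trunc hτ0.le
  have htail : ∀ p : Fin d × Fin d, μ.real {ω | u ≤ |(N : ℝ)⁻¹ * ∑ i,
      (truncDesign τ x ω i p.1 * truncDesign τ x ω i p.2 - secondMoment μ (x i) p.1 p.2)|} ≤
      2 * Real.exp (-(N * (s * u - s * (2 * M / T ^ 2) - s ^ 2 * (Real.exp c * M)))) := by
    rintro ⟨j, k⟩
    have hmom := fun i => trunc_mul_trunc_moments (hxm i j) (hxm i k) (hx4 i j).1 (hx4 i j).2
      (hx4 i k).1 (hx4 i k).2 (hxx i j k) hT hτ hτ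
    have hZm : ∀ i, Measurable fun ω => trunc τ (x i ω j) * trunc τ (x i ω k) := fun i =>
      (htr.comp (hxm i j)).mul (htr.comp (hxm i k))
    have hbern := fun i => bernstein_of_bounded (s := s) (c := c) (hZm i) (fun ω => by
      refine le_trans ?_ hc
      rw [abs_mul]
      gcongr
      · exact abs_trunc_le hτ0.le _
      · exact abs_trunc_le hτ0.le _) (hmom i).2.1 (hmom i).2.2.1
    have hf : Measurable fun p : (Fin d → ℝ) × ℝ => trunc τ (p.1 j) * trunc τ (p.1 k) :=
      (htr.comp ((measurable_pi_apply j).comp measurable_fst)).mul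
        (htr.comp ((measurable_pi_apply k).comp measurable_fst))
    exact measureReal_abs_mean_ge_le (m := fun i => secondMoment μ (x i) j k)
      (Z := fun i ω => trunc τ (x i ω j) * trunc τ (x i ω k)) hN hZm
      (h.indep_comp (f := fun v _ => trunc τ (v j) * trunc τ (v k)) hf) hs
      (fun i => (hmom i).1) (fun i => (hbern i).1) (fun i => (hbern i).2)
      (fun i => (hmom i).2.2.2) u
  have hfin := measureReal_le_of_forall
    (s := {ω | RestrictedBoundFails (truncDesign τ x ω) κL u}) (fun ω hω => ?_) htail
  · simpa using hfin
  · by_contra hcon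
    simp only [Set.mem_iUnion, Set.mem_ofPred_eq, not_exists, not_le, Prod.forall] at hcon hω
    refine not_restrictedBoundFails_of_entries hN (A := fun i => secondMoment μ (x i))
      (fun i v => (hD.minEigenvalue i).le_quadratic (secondMoment_isHermitian _) v) hu
      (fun j k => (hcon j k).le) hω

end BoundedMoments

/-! ### Constants for the design with bounded fourth moments -/

/-- The union bound over `d²` entries is absorbed by the exponent `3δ`. -/
lemma union_bound_entries_le {d : ℕ} (hd : 2 ≤ d) {δ : ℝ} (hδ : 1 ≤ δ) :
    (d * d : ℝ) * (2 * Real.exp (-(3 * (δ * Real.log d)))) ≤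
      d * Real.exp (-(δ * Real.log d)) := by
  have hd2 : (2 : ℝ) ≤ d := by exact_mod_cast hd
  have hL0 : 0 < Real.log d := Real.log_pos (by linarith)
  have hexpL : Real.exp (Real.log d) = d := Real.exp_log (by linarith)
  have h2 : Real.exp (-(3 * (δ * Real.log d))) = Real.exp (-(δ * Real.log d)) ^ 3 := by
    rw [← Real.exp_nat_mul]; congr 1; push_cast; ring
  rw [h2]
  have h1 : Real.exp (-(δ * Real.log d)) * d ≤ 1 := by
    calc Real.exp (-(δ * Real.log d)) * d
        = Real.exp (-(δ * Real.log d)) * Real.exp (Real.log d) := by rw [hexpL]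
      _ = Real.exp (-(δ * Real.log d) + Real.log d) := (Real.exp_add _ _).symm
      _ ≤ 1 := Real.exp_le_one_iff.2 (by nlinarith)
  set r := Real.exp (-(δ * Real.log d)) with hr
  have hr0 : 0 < r := Real.exp_pos _
  have h3 : 2 * r ≤ 1 := by nlinarith
  calc (d * d : ℝ) * (2 * r ^ 3) = d * r * ((r * d) * (2 * r)) := by ring
    _ ≤ d * r * (1 * 1) := by gcongr
    _ = d * r := by ring

/-- The constants for the design with bounded fourth moments. -/
theorem exists_constants_boundedMoment {κL M R a b : ℝ} (hκL : 0 < κL) (hM : 0 < M)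
    (hR : 0 < R) (ha : 0 < a) (hab : a ≤ b) :
    ∃ ν₂ C₅ C₆ : ℝ, 0 < ν₂ ∧ 0 < C₅ ∧ 0 < C₆ ∧ ∀ δ : ℝ, 0 < δ →
      ∃ C₄ : ℝ, 0 < C₄ ∧
      ∀ (Ω : Type*) [MeasurableSpace Ω] (μ : Measure Ω) [IsProbabilityMeasure μ]
        (d N : ℕ) (x : Fin N → Ω → Fin d → ℝ) (ε Y : Fin N → Ω → ℝ) (θs : Fin d → ℝ)
        (τ₁ τ₂ : ℝ),
        2 ≤ d → 1 ≤ N →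
        IsLinearModel μ x ε Y θs →
        l1Norm θs ≤ R →
        BoundedMomentDesign μ x M κL →
        (∀ i, absMoment μ 4 (Y i) ≤ ENNReal.ofReal M) →
        a * (N / (δ * Real.log d)) ^ (1 / 4 : ℝ) ≤ τ₁ →
        τ₁ ≤ b * (N / (δ * Real.log d)) ^ (1 / 4 : ℝ) →
        a * (N / (δ * Real.log d)) ^ (1 / 4 : ℝ) ≤ τ₂ →
        τ₂ ≤ b * (N / (δ * Real.log d)) ^ (1 / 4 : ℝ) →
        μ.real {ω | ν₂ * √(δ * Real.log d / N) <
            scoreNorm (truncResponse τ₁ Y ω)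
              (truncDesign τ₂ x ω) θs} ≤ 2 * (d : ℝ) ^ (1 - δ) ∧
        (∀ q ρ : ℝ, 0 ≤ q → q ≤ 1 → 1 < ρ → lqSum q θs ≤ ρ →
          ρ * (Real.log d / N) ^ ((1 - q) / 2) ≤ C₄ →
          ∀ θhat : Ω → Fin d → ℝ,
          (∀ ω, IsEstimate (truncResponse τ₁ Y ω)
            (truncDesign τ₂ x ω) (2 * ν₂ * √(δ * Real.log d / N)) (θhat ω)) →
          μ.real {ω |
              C₅ * ρ * (δ * Real.log d / N) ^ (1 - q / 2) <
                l2Norm (θhat ω - θs) ^ 2 ∨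
              C₆ * ρ * (δ * Real.log d / N) ^ ((1 - q) / 2) <
                l1Norm (θhat ω - θs)} ≤ 3 * (d : ℝ) ^ (1 - δ)) := by
  have hb : 0 < b := ha.trans_le hab
  -- in both constants: truncation bias, then variance, in units of `s = √(δ log d / N)`; the
  -- remainder is the exponent left in the tail bound
  set V := Real.exp (b ^ 2 * (1 + R)) * (2 * M * (1 + R ^ 2)) with hV
  set ν := (1 + R) * (2 * M / a ^ 2) + V + 1 with hν
  have hν0 : 0 < ν := by positivity
  set ν' := 2 * M / a ^ 2 + Real.exp (b ^ 2) * M + 3 with hν'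
  have hν'0 : 0 < ν' := by positivity
  refine ⟨ν, 2 + 144 * ν ^ 2 / κL ^ 2 + 32 * ν / κL,
    4 * √(2 + 144 * ν ^ 2 / κL ^ 2 + 32 * ν / κL) + 4, hν0, by positivity, by positivity,
    fun δ hδ => ⟨κL / (64 * (ν' * √δ)), by positivity, ?_⟩⟩
  intro Ω _ μ _ d N x ε Y θ τ₁ τ₂ hd hN hmod hθ hdes hY hτ1a hτ1b hτ2a hτ2b
  rcases le_or_gt δ 1 with hδ1 | hδ1
  · exact ⟨measureReal_le_mul_rpow_of_le_one hd hδ1 (by norm_num) _,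
      fun _ _ _ _ _ _ _ _ _ => measureReal_le_mul_rpow_of_le_one hd hδ1 (by norm_num) _⟩
  have hN0 : (0 : ℝ) < N := by exact_mod_cast hN
  have hd2 : (2 : ℝ) ≤ d := by exact_mod_cast hd
  have hL0 : 0 < Real.log d := Real.log_pos (by linarith)
  set L := Real.log d with hL
  have ht : 0 < δ * L / N := by positivity
  set s := √(δ * L / N) with hs
  have hs0 : 0 < s := Real.sqrt_pos.2 ht
  have hs2 : s ^ 2 = δ * L / N := Real.sq_sqrt ht.le
  have hNs : N * s ^ 2 = δ * L := by rw [hs2]; field_simp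
  set T : ℝ := (N / (δ * L)) ^ (1 / 4 : ℝ) with hT
  have hT0 : 0 < T := by positivity
  have hT4 : T ^ 4 = N / (δ * L) := by
    rw [hT, ← Real.rpow_natCast, ← Real.rpow_mul (by positivity)]; norm_num
  -- the truncation level is `s ^ (-1/2)` up to constants
  have hsT : s * T ^ 2 = 1 := by
    refine (pow_eq_one_iff_of_nonneg (by positivity) two_ne_zero).1 ?_
    rw [mul_pow, hs2, ← pow_mul, hT4]; field_simp
  have hprod : ∀ τ τ' : ℝ, 0 ≤ τ → 0 ≤ τ' → τ ≤ b * T → τ' ≤ b * T → s * (τ * τ') ≤ b ^ 2 := by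
    intro τ τ' h0 h0' h1 h2
    calc s * (τ * τ') ≤ s * (b * T * (b * T)) := by gcongr
      _ = b ^ 2 * (s * T ^ 2) := by ring
      _ = b ^ 2 := by rw [hsT, mul_one]
  have haT : 0 < a * T := by positivity
  have hτ10 := haT.trans_le hτ1a
  have hτ20 := haT.trans_le hτ2a
  have hbias : 2 * M / (a * T) ^ 2 = 2 * M / a ^ 2 * s := by
    rw [mul_pow]
    field_simp
    linarith
  have hscore : μ.real {ω | ν * s < scoreNorm (truncResponse τ₁ Y ω) (truncDesign τ₂ x ω) θ} ≤
      2 * (d : ℝ) ^ (1 - δ) := by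
    refine (measureReal_mono fun ω hω => ?_).trans
      ((hdes.measureReal_score_le hM.le hN hmod hθ hY hs0 haT hτ1a hτ2a
        (by positivity : 0 < ν * s) (hprod τ₁ τ₂ hτ10.le hτ20.le hτ1b hτ2b)
        (hprod τ₂ τ₂ hτ20.le hτ20.le hτ2b hτ2b)).trans (le_of_eq ?_))
    · simp only [Set.mem_ofPred_eq] at hω ⊢
      exact hω.le
    · rw [rpow_one_sub_eq hd, mul_left_comm, hbias, ← hV, ← hNs, hν]
      congr 4; ring
  refine ⟨hscore, ?_⟩
  intro q ρ hq0 hq1 hρ hlq hC θhat hest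
  have hrsc : μ.real {ω | RestrictedBoundFails (truncDesign τ₂ x ω) κL (ν' * s)} ≤
      (d : ℝ) ^ (1 - δ) := by
    refine (hdes.measureReal_restrictedBoundFails_le hM.le hN hmod hs0 haT hτ2a
      (by positivity : 0 ≤ ν' * s) (hprod τ₂ τ₂ hτ20.le hτ20.le hτ2b hτ2b)).trans ?_
    have e1 : N * (s * (ν' * s) - s * (2 * M / (a * T) ^ 2) - s ^ 2 * (Real.exp (b ^ 2) * M)) =
        3 * (δ * L) := by
      rw [hbias, ← hNs, hν']; ring
    rw [e1, rpow_one_sub_eq hd]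
    exact union_bound_entries_le hd hδ1.le
  refine measureReal_estimate_error_le ht hν0 hκL (by positivity) hq0 hq1 (by linarith) hlq hest
    hscore hrsc ?_
  have hy0 : 0 < L / N := by positivity
  have e1 : s * s ^ (-q) = δ ^ ((1 - q) / 2) * (L / N) ^ ((1 - q) / 2) := by
    rw [← Real.mul_rpow hδ.le hy0.le, ← mul_div_assoc]
    nth_rewrite 1 [← Real.rpow_one s]
    rw [← Real.rpow_add hs0, hs, Real.sqrt_eq_rpow, ← Real.rpow_mul ht.le]
    congr 1; ring
  have e2 : δ ^ ((1 - q) / 2) ≤ √δ := by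
    rw [Real.sqrt_eq_rpow]
    exact Real.rpow_le_rpow_of_exponent_le hδ1.le (by linarith)
  calc ν' * s * (ρ * s ^ (-q)) = ν' * ρ * (s * s ^ (-q)) := by ring
    _ = ν' * δ ^ ((1 - q) / 2) * (ρ * (L / N) ^ ((1 - q) / 2)) := by rw [e1]; ring
    _ ≤ ν' * √δ * (κL / (64 * (ν' * √δ))) := by gcongr
    _ = κL / 64 := by field_simp

end RobustRegression

theorem theorem2 :
    -- Part (a): sub-Gaussian design
    (∀ κ₀ κL M k a b : ℝ, 0 < κ₀ → 0 < κL → 0 < M → 1 < k → 0 < a → a ≤ b →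
      ∃ ν₁ C₂ C₃ : ℝ, 0 < ν₁ ∧ 0 < C₂ ∧ 0 < C₃ ∧ ∀ δ : ℝ, 0 < δ →
      ∃ γ₁ C₁ : ℝ, 0 < γ₁ ∧ 0 < C₁ ∧
      ∀ (Ω : Type*) [MeasurableSpace Ω] (μ : Measure Ω) [IsProbabilityMeasure μ]
        (d N : ℕ) (x : Fin N → Ω → Fin d → ℝ) (ε Y : Fin N → Ω → ℝ) (θs : Fin d → ℝ) (τ : ℝ),
        2 ≤ d → 1 ≤ N →
        RobustRegression.IsLinearModel μ x ε Y θs →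
        RobustRegression.SubGaussianDesign μ x κ₀ κL →
        (∀ i, RobustRegression.absMoment μ (2 * k) (Y i) ≤ ENNReal.ofReal M) →
        a * √(N / Real.log d) ≤ τ → τ ≤ b * √(N / Real.log d) →
        (Real.log d / N < γ₁ →
          μ.real {ω | ν₁ * √(δ * Real.log d / N) ≤
            RobustRegression.scoreNorm (RobustRegression.truncResponse τ Y ω)
              (RobustRegression.design x ω) θs} ≤ 2 * (d : ℝ) ^ (1 - δ)) ∧
        (∀ q ρ : ℝ, 0 ≤ q → q ≤ 1 → 1 < ρ → RobustRegression.lqSum q θs ≤ ρ →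
          ρ * (Real.log d / N) ^ (1 - q / 2) ≤ C₁ →
          ∀ θhat : Ω → Fin d → ℝ,
          (∀ ω, RobustRegression.IsEstimate (RobustRegression.truncResponse τ Y ω)
            (RobustRegression.design x ω) (2 * ν₁ * √(δ * Real.log d / N)) (θhat ω)) →
          μ.real {ω |
              C₂ * ρ * (δ * Real.log d / N) ^ (1 - q / 2) <
                RobustRegression.l2Norm (θhat ω - θs) ^ 2 ∨
              C₃ * ρ * (δ * Real.log d / N) ^ ((1 - q) / 2) <
                RobustRegression.l1Norm (θhat ω - θs)} ≤ 3 * (d : ℝ) ^ (1 - δ))) ∧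
    -- Part (b): design with bounded fourth moments
    (∀ κL M R a b : ℝ, 0 < κL → 0 < M → 0 < R → 0 < a → a ≤ b →
      ∃ ν₂ C₅ C₆ : ℝ, 0 < ν₂ ∧ 0 < C₅ ∧ 0 < C₆ ∧ ∀ δ : ℝ, 0 < δ →
      ∃ C₄ : ℝ, 0 < C₄ ∧
      ∀ (Ω : Type*) [MeasurableSpace Ω] (μ : Measure Ω) [IsProbabilityMeasure μ]
        (d N : ℕ) (x : Fin N → Ω → Fin d → ℝ) (ε Y : Fin N → Ω → ℝ) (θs : Fin d → ℝ)
        (τ₁ τ₂ : ℝ),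
        2 ≤ d → 1 ≤ N →
        RobustRegression.IsLinearModel μ x ε Y θs →
        RobustRegression.l1Norm θs ≤ R →
        RobustRegression.BoundedMomentDesign μ x M κL →
        (∀ i, RobustRegression.absMoment μ 4 (Y i) ≤ ENNReal.ofReal M) →
        a * (N / (δ * Real.log d)) ^ (1 / 4 : ℝ) ≤ τ₁ →
        τ₁ ≤ b * (N / (δ * Real.log d)) ^ (1 / 4 : ℝ) →
        a * (N / (δ * Real.log d)) ^ (1 / 4 : ℝ) ≤ τ₂ →
        τ₂ ≤ b * (N / (δ * Real.log d)) ^ (1 / 4 : ℝ) →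
        μ.real {ω | ν₂ * √(δ * Real.log d / N) <
            RobustRegression.scoreNorm (RobustRegression.truncResponse τ₁ Y ω)
              (RobustRegression.truncDesign τ₂ x ω) θs} ≤ 2 * (d : ℝ) ^ (1 - δ) ∧
        (∀ q ρ : ℝ, 0 ≤ q → q ≤ 1 → 1 < ρ → RobustRegression.lqSum q θs ≤ ρ →
          ρ * (Real.log d / N) ^ ((1 - q) / 2) ≤ C₄ →
          ∀ θhat : Ω → Fin d → ℝ,
          (∀ ω, RobustRegression.IsEstimate (RobustRegression.truncResponse τ₁ Y ω)
            (RobustRegression.truncDesign τ₂ x ω) (2 * ν₂ * √(δ * Real.log d / N)) (θhat ω)) →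
          μ.real {ω |
              C₅ * ρ * (δ * Real.log d / N) ^ (1 - q / 2) <
                RobustRegression.l2Norm (θhat ω - θs) ^ 2 ∨
              C₆ * ρ * (δ * Real.log d / N) ^ ((1 - q) / 2) <
                RobustRegression.l1Norm (θhat ω - θs)} ≤ 3 * (d : ℝ) ^ (1 - δ))) :=
  ⟨fun _ _ _ _ _ _ hκ₀ hκL hM hk ha hab =>
      RobustRegression.exists_constants_subGaussian hκ₀ hκL hM hk ha hab,
    fun _ _ _ _ _ hκL hM hR ha hab =>
      RobustRegression.exists_constants_boundedMoment hκL hM hR ha hab⟩
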